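/- **Setting.** Let $N,d\ge 1$ and let $\mathbf y_i=\mathbf f^i+\varepsilon_i$, $i=1,\dots,N$, where the $\mathbf f^i\in\mathbb R^d$ are nonrandom and $\varepsilon_1,\dots,\varepsilon_N$ are i.i.d. random vectors in $\mathbb R^d$ with $\mathbb E(\varepsilon_1)=0$ and covariance matrix $\Phi$. Write $\mathbf f,\mathbf y\in\mathbb R^{Nd}$ for the stacked vectors, $\|\cdot\|$ for the Euclidean norm of $\mathbb R^d$, and $\|\cdot\|_N$ for the norm of $\mathbb R^{Nd}$ associated with $\langle a,b\rangle_N=\frac1N\sum_{i=1}^N a_i^Tb_i$. Let $(\mathcal L_m)_{m\in\mathcal M}$ be a finite non-empty family of linear subspaces of $\mathbb R^{Nd}$ with dimensions $D_m\ge 1$, let $\mathbf P_m$ be the orthogonal projector onto $\mathcal L_m$, so that $\hat{\mathbf f}_m=\mathbf P_m\mathbf y$ is the least squares estimator in the model $\mathcal L_m$, and put $$\delta_m^2=\frac{\mathrm{Tr}(\mathbf P_m(\mathbf I_N\otimes\Phi))}{D_m},\qquad \delta_{\sup}^2=\max_{m\in\mathcal M}\delta_m^2 .$$ Assume $\delta_m>0$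 for all $m\in\mathcal M$. Given $\theta>0$, let $\tilde{\mathbf f}=\hat{\mathbf f}_{\hat m}$, where $\hat m$ is a (measurable) minimizer over $m\in\mathcal M$ of $$\|\mathbf y-\hat{\mathbf f}_m\|_N^2+\mathrm{pen}(m),\qquad \mathrm{pen}(m)=(1+\theta)\frac{\delta_m^2D_m}{N}.$$ **Corollary 4.2.** For every $\theta>0$ there is a constant $K(\theta)>1$ depending only on $\theta$, and for all $q>0$ and $p>2(1+q)$ there is a constant $C(\theta,p,q)>0$ depending only on $\theta,p,q$, such that in the above setting, if $\mathbb E\|\varepsilon_1\|^p<\infty$, then $\mathbb E\|\mathbf f-\tilde{\mathbf f}\|_N^{2q}<\infty$ and $$\left(\mathbb E\|\mathbf f-\tilde{\mathbf f}\|_N^{2q}\right)^{1/q}\le 2^{(q-1)_+}\left[K(\theta)\inf_{m\in\mathcal M}\left(\|\mathbf f-\mathbf P_m\mathbf f\|_N^2+\frac{\delta_m^2D_m}{N}\right)+\frac{\Delta_p}{N}\,\delta_{\sup}^2\right],$$ where $\Delta_p\ge 0$ is given by $$\Delta_p^q=C(\theta,p,q)\,\mathbb E\|\varepsilon_1\|^p\sum_{m\in\mathcal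 M}\delta_m^{-p}D_m^{-(p/2-1-q)} .$$ -/

import Mathlib

open MeasureTheory ProbabilityTheory
open scoped Kronecker

namespace MultiReg

/-- The space `ℝ^{Nd}`; the coordinate `(i, j)` is the `j`-th coordinate of the `i`-th block. -/
abbrev Vec (N d : ℕ) : Type := EuclideanSpace ℝ (Fin N × Fin d)

/-- The stacked vector `(v₁ᵀ, …, v_Nᵀ)ᵀ ∈ ℝ^{Nd}` of `N` vectors of `ℝ^d`. -/
def stack {N d : ℕ} (v : Fin N → EuclideanSpace ℝ (Fin d)) : Vec N d :=
  WithLp.toLp 2 fun ij => v ij.1 ij.2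

/-- The inner product `⟨a, b⟩_N = (1/N) ∑ᵢ aᵢᵀ bᵢ` of `ℝ^{Nd}`. -/
noncomputable def innerN {N d : ℕ} (a b : Vec N d) : ℝ :=
  (1 / (N : ℝ)) * ∑ i : Fin N, ∑ j : Fin d, a (i, j) * b (i, j)

/-- The norm `‖a‖_N` associated with `⟨·, ·⟩_N`. -/
noncomputable def normN {N d : ℕ} (a : Vec N d) : ℝ := Real.sqrt (innerN a a)

/-- The covariance matrix of a random vector of `ℝ^d`. -/
noncomputable def covMatrix {d : ℕ} {Ω : Type*} [MeasurableSpace Ω] (μ : Measure Ω)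
    (X : Ω → EuclideanSpace ℝ (Fin d)) : Matrix (Fin d) (Fin d) ℝ :=
  Matrix.of fun j k => covariance (fun ω => X ω j) (fun ω => X ω k) μ

/-- The orthogonal projection of `ℝ^{Nd}` onto `L`. As `⟨·, ·⟩_N` is a multiple of the Euclidean
inner product, it is orthogonal for both. -/
noncomputable def proj {N d : ℕ} (L : Submodule ℝ (Vec N d)) (x : Vec N d) : Vec N d :=
  L.starProjection x

/-- The matrix of the orthogonal projection onto `L` in the canonical basis of `ℝ^{Nd}`. -/
noncomputable def projMatrix {N d : ℕ} (L : Submodule ℝ (Vec N d)) :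
    Matrix (Fin N × Fin d) (Fin N × Fin d) ℝ :=
  Matrix.of fun a b => proj L (EuclideanSpace.single b (1 : ℝ)) a

/-- The dimension `D` of the model `L`. -/
noncomputable def dimM {N d : ℕ} (L : Submodule ℝ (Vec N d)) : ℕ := Module.finrank ℝ L

/-- `δ² = Tr(P (I_N ⊗ Φ)) / D` for the model `L` with orthogonal projector `P` and dimension `D`. -/
noncomputable def deltaSq {N d : ℕ} (Φ : Matrix (Fin d) (Fin d) ℝ)
    (L : Submodule ℝ (Vec N d)) : ℝ :=
  (projMatrix L * ((1 : Matrix (Fin N) (Fin N) ℝ) ⊗ₖ Φ)).trace / (dimM L : ℝ)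

/-- `δ_sup² = max_m δ_m²` (a maximum over a finite non-empty family of models). -/
noncomputable def deltaSupSq {N d : ℕ} {ι : Type*} (Φ : Matrix (Fin d) (Fin d) ℝ)
    (L : ι → Submodule ℝ (Vec N d)) : ℝ :=
  ⨆ m, deltaSq Φ (L m)

/-- `pen(m) = (1 + θ) δ_m² D_m / N`. -/
noncomputable def pen {N d : ℕ} (θ : ℝ) (Φ : Matrix (Fin d) (Fin d) ℝ)
    (L : Submodule ℝ (Vec N d)) : ℝ :=
  (1 + θ) * (deltaSq Φ L * (dimM L : ℝ) / (N : ℝ))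

/-- `m` minimizes the penalized criterion `m' ↦ ‖y - P_{m'} y‖_N² + pen(m')`, where `P_{m'} y` is
the least squares estimator in the model `L m'` based on the data `y`. -/
def IsPenalizedChoice {N d : ℕ} {ι : Type*} (θ : ℝ) (Φ : Matrix (Fin d) (Fin d) ℝ)
    (L : ι → Submodule ℝ (Vec N d)) (y : Vec N d) (m : ι) : Prop :=
  ∀ m' : ι, normN (y - proj (L m) y) ^ 2 + pen θ Φ (L m)
    ≤ normN (y - proj (L m') y) ^ 2 + pen θ Φ (L m')

/-- `inf_m { ‖f - P_m f‖_N² + δ_m² D_m / N }`. -/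
noncomputable def oracle {N d : ℕ} {ι : Type*} (Φ : Matrix (Fin d) (Fin d) ℝ)
    (L : ι → Submodule ℝ (Vec N d)) (f : Vec N d) : ℝ :=
  ⨅ m, (normN (f - proj (L m) f) ^ 2 + deltaSq Φ (L m) * (dimM (L m) : ℝ) / (N : ℝ))

/-- `Δ_p`, where `Δ_p^q = C · M · ∑_m δ_m^{-p} D_m^{-(p/2-1-q)}` and `M` stands for
the moment `E ‖ε₁‖^p`. -/
noncomputable def Delta {N d : ℕ} {ι : Type*} [Fintype ι] (C p q M : ℝ)
    (Φ : Matrix (Fin d) (Fin d) ℝ) (L : ι → Submodule ℝ (Vec N d)) : ℝ :=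
  (C * M * ∑ m, Real.sqrt (deltaSq Φ (L m)) ^ (-p)
    * (dimM (L m) : ℝ) ^ (-(p / 2 - 1 - q))) ^ (1 / q)

end MultiReg

/-!
The loss of the selected model splits into a bias and the projected noise `‖P ε‖²`. Comparing the
penalized criteria of the selected model and of an arbitrary one, the surplus `θ δ² D` of the
penalty over the mean `δ² D = 𝔼 ‖P ε‖²` pays for the noise of the selected model and for the cross
term between noise and bias, except for the *excess noise*
`(‖P ε‖² - (1 + θ/4) δ² D)₊ + (⟪ε, u⟫² - (θ/8) δ² D)₊`, where `u` is the direction of the bias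
(`norm_sq_sub_le_of_penalized_le`). The excess noise of the selected model is bounded by the sum
over all models, so it remains to bound its moment of order `q` for each model by a multiple of
`𝔼 ‖ε₁‖ ^ p δ ^ (2 q - p) D ^ (1 + q - p / 2)` (`exists_integral_excess_rpow_le`).

For this, write `P ε = ∑ i, X i` with independent centred vectors `X i`, the projections of the
blocks of `ε`, and put `S = δ² D` and `B = D 𝔼 ‖ε₁‖ ^ p`. Then `∑ i, 𝔼 ‖X i‖ ^ p ≤ B`, because the
squared operator norms of `P` on the blocks sum up to at most the trace `D`. The two parts of
`‖∑ i, X i‖² = ∑ i, ‖X i‖² + ∑ i ≠ j, ⟪X i, X j⟫` are treated separately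
(`exists_integral_max_norm_sq_sum_sub_rpow_le`).

* The diagonal part is a sum of independent nonnegative variables. Above `1 + α` times its mean its
  moment of order `p / 2` is at most a constant times `B`, without a variance term, since the
  surplus `α` acts as a negative drift (`exists_integral_max_sum_sub_rpow_le`).
* The off-diagonal part is an average of the products `4 ⟪∑ i ∈ A, X i, ∑ i ∉ A, X i⟫` over all sets
  `A` of indices (`norm_sq_sum_sub_sum_norm_sq`). Given the first sum, the second factor is a sum of
  independent real variables whose variance involves only the weak variance of the noise.
  Rosenthal's inequality (`exists_integral_norm_sum_rpow_le`), used once for each factor,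
  bounds the moment of order `p` by a constant times `(S ^ (p / 2) + B) B`
  (`exists_integral_abs_offDiag_rpow_le`).

The passage from moments of order `p / 2` or `p` to order `q` uses the threshold, a multiple of `S`.
The term `⟪ε, u⟫²` of the excess noise is bounded by Rosenthal's inequality alone.
-/

namespace MultiReg

/-! ### Elementary inequalities for real powers -/

/-- A convex power lies above its tangent lines. -/
theorem rpow_tangent_le {s x y : ℝ} (hs : 1 ≤ s) (hx : 0 ≤ x) (hy : 0 ≤ y) :
    x ^ s + s * x ^ (s - 1) * (y - x) ≤ y ^ s := by
  rcases hx.eq_or_lt with rfl | hx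
  · rcases hs.eq_or_lt with rfl | hs
    · simp
    · rw [Real.zero_rpow (by linarith), Real.zero_rpow (by linarith)]
      simpa using Real.rpow_nonneg hy s
  · have h := one_add_mul_self_le_rpow_one_add (s := (y - x) / x)
      (by rw [le_div_iff₀ hx]; linarith) hs
    have h1 : 1 + (y - x) / x = y / x := by field_simp; ring
    rw [h1, Real.div_rpow hy hx.le, le_div_iff₀ (Real.rpow_pos_of_pos hx s)] at h
    have h2 : x ^ s = x ^ (s - 1) * x := by
      rw [← Real.rpow_add_one hx.ne']; congr 1; ring
    calc x ^ s + s * x ^ (s - 1) * (y - x)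
        = (1 + s * ((y - x) / x)) * x ^ s := by rw [h2]; field_simp
      _ ≤ y ^ s := h

/-- First-order bound with a slack `η` on the linear term: the slack absorbs the second-order
term when `x` is small compared with `t`, and `x ^ s` dominates everything otherwise. -/
theorem exists_add_rpow_le {s η : ℝ} (hs : 1 ≤ s) (hη : 0 < η) :
    ∃ C : ℝ, 1 ≤ C ∧ ∀ t x : ℝ, 0 ≤ t → 0 ≤ x →
      (t + x) ^ s ≤ t ^ s + (1 + η) * (s * t ^ (s - 1) * x) + C * x ^ s := by
  obtain ⟨c, hc, hcs⟩ : ∃ c : ℝ, 0 < c ∧ (1 + c) ^ s = 1 + η := by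
    refine ⟨(1 + η) ^ (1 / s) - 1, ?_, ?_⟩
    · have := Real.one_lt_rpow (x := 1 + η) (z := 1 / s) (by linarith) (by positivity)
      linarith
    · rw [add_sub_cancel, ← Real.rpow_mul (by linarith), one_div, inv_mul_cancel₀ (by linarith),
        Real.rpow_one]
  refine ⟨(1 / c + 1) ^ s, ?_, fun t x ht hx => ?_⟩
  · exact Real.one_le_rpow (by have : 0 < 1 / c := by positivity
                               linarith) (by linarith)
  · have hs0 : (0 : ℝ) ≤ s - 1 := by linarith
    rcases le_total x (c * t) with h | h
    · have h1 := rpow_tangent_le hs (add_nonneg ht hx) ht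
      have h2 : (t + x) ^ (s - 1) ≤ (1 + η) * t ^ (s - 1) := by
        calc (t + x) ^ (s - 1) ≤ ((1 + c) * t) ^ (s - 1) :=
              Real.rpow_le_rpow (by positivity) (by linarith) hs0
          _ = (1 + c) ^ (s - 1) * t ^ (s - 1) := Real.mul_rpow (by linarith) ht
          _ ≤ (1 + η) * t ^ (s - 1) := by
              gcongr
              rw [← hcs]
              exact Real.rpow_le_rpow_of_exponent_le (by linarith) (by linarith)
      have h3 : s * (t + x) ^ (s - 1) * x ≤ s * ((1 + η) * t ^ (s - 1)) * x := by gcongr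
      have h4 : 0 ≤ (1 / c + 1) ^ s * x ^ s := by positivity
      linarith
    · have h1 : (t + x) ^ s ≤ (1 / c + 1) ^ s * x ^ s := by
        rw [← Real.mul_rpow (by positivity) hx]
        refine Real.rpow_le_rpow (by positivity) ?_ (by linarith)
        have : t ≤ 1 / c * x := by
          rw [one_div, ← div_eq_inv_mul, le_div_iff₀ hc]; linarith
        linarith
      have : 0 ≤ t ^ s + (1 + η) * (s * t ^ (s - 1) * x) := by positivity
      linarith

theorem exists_abs_one_add_rpow_sub_one_le {s : ℝ} (hs : 0 ≤ s) :
    ∃ C : ℝ, 0 ≤ C ∧ ∀ w : ℝ, |w| ≤ 1 → |(1 + w) ^ s - 1| ≤ C * |w| := by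
  obtain ⟨n, hn⟩ := exists_nat_ge s
  refine ⟨2 ^ n + n, by positivity, fun w hw => ?_⟩
  obtain ⟨hw1, hw2⟩ := abs_le.1 hw
  rcases le_total 0 w with h | h
  · rw [abs_of_nonneg h, abs_of_nonneg (sub_nonneg.2 (Real.one_le_rpow (by linarith) hs))]
    have h1 : (1 + w) ^ s ≤ (1 + w) ^ n := by
      rw [← Real.rpow_natCast]
      exact Real.rpow_le_rpow_of_exponent_le (by linarith) hn
    have h2 : ∀ k : ℕ, (1 + w) ^ k ≤ 1 + (2 ^ k - 1) * w := by
      intro k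
      induction k with
      | zero => simp
      | succ k ih =>
        have h3 : (1 : ℝ) ≤ 2 ^ k := one_le_pow₀ (by norm_num)
        rw [pow_succ, pow_succ]
        have h4 := mul_le_mul_of_nonneg_right ih (by linarith : 0 ≤ 1 + w)
        have h5 : 0 ≤ ((2 : ℝ) ^ k - 1) * (w * (1 - w)) :=
          mul_nonneg (by linarith) (mul_nonneg h (by linarith))
        nlinarith
    have h4 := h2 n
    nlinarith [mul_nonneg (Nat.cast_nonneg (α := ℝ) n) h]
  · rw [abs_of_nonpos h, abs_of_nonpos (sub_nonpos.2 (Real.rpow_le_one (by linarith)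
      (by linarith) hs))]
    rcases hw1.eq_or_lt with rfl | hw1
    · have h5 : (1 : ℝ) ≤ 2 ^ n := one_le_pow₀ (by norm_num)
      have h6 := Real.rpow_nonneg (x := (1 : ℝ) + -1) (by norm_num) s
      have h7 := Nat.cast_nonneg (α := ℝ) n
      linarith
    · have h1 : (1 + w) ^ n ≤ (1 + w) ^ s := by
        rw [← Real.rpow_natCast]
        exact Real.rpow_le_rpow_of_exponent_ge (by linarith) (by linarith) hn
      have h2 := one_add_mul_le_pow (a := w) (by linarith) n
      have h3 : 0 ≤ (2 : ℝ) ^ n * (-w) := mul_nonneg (by positivity) (by linarith)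
      nlinarith

/-- Second-order expansion of `‖t + v‖ ^ p` in a Hilbert space: the linear term is kept exactly,
so that it vanishes after integration against a centred `v`. -/
theorem exists_norm_add_rpow_le.{v} {p : ℝ} (hp : 2 ≤ p) :
    ∃ C : ℝ, 0 ≤ C ∧ ∀ {H : Type v} [NormedAddCommGroup H] [InnerProductSpace ℝ H] (t v : H),
      ‖t + v‖ ^ p ≤ ‖t‖ ^ p + p * ‖t‖ ^ (p - 2) * inner ℝ t v
        + C * (‖t‖ ^ (p - 2) * ‖v‖ ^ 2 + ‖v‖ ^ p) := by
  obtain ⟨c, hc0, hc⟩ := exists_abs_one_add_rpow_sub_one_le (s := p / 2 - 1) (by linarith)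
  refine ⟨(5 : ℝ) ^ p + p * 4 ^ (p - 1) + (p + 6 * p * c), by positivity, ?_⟩
  intro H _ _ t v
  have ha : 0 ≤ ‖t‖ := norm_nonneg t
  have hb : 0 ≤ ‖v‖ := norm_nonneg v
  have hin := abs_le.1 (abs_real_inner_le_norm t v)
  have hX : 0 ≤ ‖t‖ ^ (p - 2) * ‖v‖ ^ 2 := by positivity
  have hY : 0 ≤ ‖v‖ ^ p := by positivity
  have h5 : 0 ≤ (5 : ℝ) ^ p := by positivity
  have h4 : 0 ≤ p * (4 : ℝ) ^ (p - 1) := by positivity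
  have h6 : 0 ≤ p + 6 * p * c := by positivity
  -- if `t` is not large compared with `v`, then `‖v‖ ^ p` dominates all terms; otherwise expand the
  -- power `p / 2` of `‖t + v‖ ^ 2 = a + z` around `a = ‖t‖ ^ 2`
  rcases le_total ‖t‖ (4 * ‖v‖) with h | h
  · have e1 : ‖t + v‖ ^ p ≤ 5 ^ p * ‖v‖ ^ p := by
      rw [← Real.mul_rpow (by norm_num) hb]
      exact Real.rpow_le_rpow (norm_nonneg _) (by linarith [norm_add_le t v]) (by linarith)
    have e2 : -(p * ‖t‖ ^ (p - 2) * inner ℝ t v) ≤ p * 4 ^ (p - 1) * ‖v‖ ^ p := by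
      calc -(p * ‖t‖ ^ (p - 2) * inner ℝ t v) = p * ‖t‖ ^ (p - 2) * (- inner ℝ t v) := by ring
        _ ≤ p * ‖t‖ ^ (p - 2) * (‖t‖ * ‖v‖) := by gcongr; linarith
        _ ≤ p * (4 * ‖v‖) ^ (p - 2) * (4 * ‖v‖ * ‖v‖) := by gcongr
        _ = p * 4 ^ (p - 1) * ‖v‖ ^ p := by
          rcases hb.eq_or_lt with h0 | h0
          · rw [← h0, Real.zero_rpow (by linarith)]; simp
          · rw [Real.mul_rpow (by norm_num) hb, show p - 1 = (p - 2) + 1 by ring,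
              Real.rpow_add_one (by norm_num), show ‖v‖ ^ p = ‖v‖ ^ (p - 2) * ‖v‖ ^ 2 by
                rw [← Real.rpow_natCast, ← Real.rpow_add h0]; norm_num]
            ring
    have e3 : 0 ≤ ‖t‖ ^ p := by positivity
    nlinarith [mul_nonneg h5 hX, mul_nonneg h4 hX, mul_nonneg h6 hX, mul_nonneg h6 hY]
  · rcases ha.eq_or_lt with h0 | h0
    · have ht : t = 0 := norm_eq_zero.1 h0.symm
      have hv : v = 0 := norm_eq_zero.1 (by linarith)
      subst ht hv
      simp [Real.zero_rpow (show p ≠ 0 by linarith)]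
    · set a := ‖t‖ ^ 2 with hadef
      have ha2 : 0 < a := by positivity
      set z := 2 * inner ℝ t v + ‖v‖ ^ 2 with hz
      have hzy : ‖t + v‖ ^ 2 = a + z := by rw [norm_add_sq_real]; ring
      have hzb : |z| ≤ 9 / 4 * (‖t‖ * ‖v‖) := by
        rw [abs_le]
        constructor <;> nlinarith
      have hw : |z / a| ≤ 1 := by
        rw [abs_div, abs_of_pos ha2, div_le_one ha2]
        nlinarith
      have key := rpow_tangent_le (s := p / 2) (x := a + z) (y := a) (by linarith)
        (by rw [← hzy]; positivity) ha2.le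
      have k1 : (a + z) ^ (p / 2 - 1) = a ^ (p / 2 - 1) * (1 + z / a) ^ (p / 2 - 1) := by
        rw [← Real.mul_rpow ha2.le (by linarith [(abs_le.1 hw).1])]
        congr 1; field_simp
      have k2 : (a + z) ^ (p / 2) = ‖t + v‖ ^ p := by
        rw [← hzy, ← Real.rpow_natCast, ← Real.rpow_mul (norm_nonneg _)]
        congr 1; push_cast; ring
      have k3 : a ^ (p / 2) = ‖t‖ ^ p := by
        rw [hadef, ← Real.rpow_natCast, ← Real.rpow_mul ha]
        congr 1; push_cast; ring
      have k4 : a ^ (p / 2 - 1) = ‖t‖ ^ (p - 2) := by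
        rw [hadef, ← Real.rpow_natCast, ← Real.rpow_mul ha]
        congr 1; push_cast; ring
      rw [k2, k3, k1, k4] at key
      set A := ‖t‖ ^ (p - 2)
      have hA : 0 ≤ A := by positivity
      have k5 : ((1 + z / a) ^ (p / 2 - 1) - 1) * z ≤ 6 * c * ‖v‖ ^ 2 := by
        calc ((1 + z / a) ^ (p / 2 - 1) - 1) * z
            ≤ |(1 + z / a) ^ (p / 2 - 1) - 1| * |z| := by rw [← abs_mul]; exact le_abs_self _
          _ ≤ c * |z / a| * |z| := by gcongr; exact hc _ hw
          _ = c * (|z| ^ 2 / a) := by rw [abs_div, abs_of_pos ha2]; ring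
          _ ≤ c * ((9 / 4 * (‖t‖ * ‖v‖)) ^ 2 / a) := by gcongr
          _ = c * (81 / 16 * ‖v‖ ^ 2) := by rw [hadef]; field_simp; ring
          _ ≤ 6 * c * ‖v‖ ^ 2 := by nlinarith [mul_nonneg hc0 (sq_nonneg ‖v‖)]
      have k6 : p / 2 * A * (((1 + z / a) ^ (p / 2 - 1) - 1) * z)
          ≤ p / 2 * A * (6 * c * ‖v‖ ^ 2) := by gcongr
      have k7 : 0 ≤ p * A * ‖v‖ ^ 2 := by positivity
      have k8 : 0 ≤ p * c * A * ‖v‖ ^ 2 := by positivity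
      have k9 : ‖t + v‖ ^ p ≤ ‖t‖ ^ p + p * A * inner ℝ t v + (p + 6 * p * c) * (A * ‖v‖ ^ 2) := by
        rw [hz] at key k6
        nlinarith
      nlinarith [mul_nonneg h5 hX, mul_nonneg h4 hX, mul_nonneg h5 hY, mul_nonneg h4 hY,
        mul_nonneg h6 hY]

/-- Young's inequality at scale `x`. -/
theorem rpow_sub_two_mul_le {p c a x : ℝ} (hp : 2 ≤ p) (hc : 0 ≤ c) (ha : 0 ≤ a) (hx : 0 ≤ x) :
    c * a ^ (p - 2) * x ^ 2 ≤ a ^ p + c ^ (p / 2) * x ^ p := by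
  have hsq : ∀ y : ℝ, 0 ≤ y → (y ^ 2) ^ (p / 2) = y ^ p := fun y hy => by
    rw [← Real.rpow_natCast, ← Real.rpow_mul hy]; congr 1; push_cast; ring
  have hsq' : ∀ y : ℝ, 0 ≤ y → (y ^ 2) ^ (p / 2 - 1) = y ^ (p - 2) := fun y hy => by
    rw [← Real.rpow_natCast, ← Real.rpow_mul hy]; congr 1; push_cast; ring
  have hm : ∀ y : ℝ, 0 ≤ y → y ^ (p / 2 - 1) * y = y ^ (p / 2) := fun y hy => by
    rcases hy.eq_or_lt with rfl | hy
    · rw [Real.zero_rpow (by linarith : p / 2 ≠ 0), mul_zero]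
    · rw [← Real.rpow_add_one hy.ne']; congr 1; ring
  rw [← hsq a ha, ← hsq x hx, ← Real.mul_rpow hc (sq_nonneg x), ← hsq' a ha]
  have h0 : 0 ≤ c * x ^ 2 := by positivity
  have h1 : 0 ≤ (a ^ 2) ^ (p / 2) := by positivity
  have h2 : 0 ≤ (c * x ^ 2) ^ (p / 2) := by positivity
  rcases le_total (c * x ^ 2) (a ^ 2) with h | h
  · calc c * (a ^ 2) ^ (p / 2 - 1) * x ^ 2 = (a ^ 2) ^ (p / 2 - 1) * (c * x ^ 2) := by ring
      _ ≤ (a ^ 2) ^ (p / 2 - 1) * a ^ 2 := by gcongr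
      _ ≤ _ := by rw [hm _ (sq_nonneg a)]; linarith
  · calc c * (a ^ 2) ^ (p / 2 - 1) * x ^ 2 = (a ^ 2) ^ (p / 2 - 1) * (c * x ^ 2) := by ring
      _ ≤ (c * x ^ 2) ^ (p / 2 - 1) * (c * x ^ 2) := by
          gcongr; linarith
      _ ≤ _ := by rw [hm _ h0]; linarith

/-- Above a threshold `c > 0`, a power `q` is controlled by any larger power `s`. -/
theorem max_sub_rpow_le {q s c y : ℝ} (hq : 0 < q) (hqs : q ≤ s) (hc : 0 < c) :
    max (y - c) 0 ^ q ≤ max y 0 ^ s * c ^ (q - s) := by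
  rcases le_total y c with h | h
  · rw [max_eq_right (by linarith), Real.zero_rpow hq.ne']; positivity
  · have hy : 0 < y := by linarith
    rw [max_eq_left (by linarith), max_eq_left hy.le]
    calc (y - c) ^ q ≤ y ^ q := Real.rpow_le_rpow (by linarith) (by linarith) hq.le
      _ = y ^ s * y ^ (q - s) := by rw [← Real.rpow_add hy]; congr 1; ring
      _ ≤ y ^ s * c ^ (q - s) :=
          mul_le_mul_of_nonneg_left (Real.rpow_le_rpow_of_nonpos hc h (by linarith))
            (Real.rpow_nonneg hy.le s)

theorem add_rpow_le_two_mul {q x y : ℝ} (hq : 0 ≤ q) (hx : 0 ≤ x) (hy : 0 ≤ y) :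
    (x + y) ^ q ≤ 2 ^ q * (x ^ q + y ^ q) := by
  have h1 : 0 ≤ x ^ q := by positivity
  have h2 : 0 ≤ y ^ q := by positivity
  have h3 : (x + y) ^ q ≤ (2 * max x y) ^ q :=
    Real.rpow_le_rpow (by positivity)
      (by linarith [le_max_left x y, le_max_right x y]) hq
  rw [Real.mul_rpow (by norm_num) (by positivity)] at h3
  refine h3.trans ?_
  gcongr
  rcases le_total x y with h | h
  · rw [max_eq_right h]; linarith
  · rw [max_eq_left h]; linarith

/-! ### Moments of sums of independent variables -/

/-- Integration in two stages against independent variables: a bound on the partial integrals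
`∫ F u (W ω) ∂μ` passes to the joint integral. -/
theorem integrable_and_integral_le_of_indepFun {Ω E E' : Type*} [MeasurableSpace Ω]
    [MeasurableSpace E] [MeasurableSpace E'] {μ : Measure Ω} [IsProbabilityMeasure μ]
    {U : Ω → E} {W : Ω → E'} (hU : Measurable U) (hW : Measurable W) (h : IndepFun U W μ)
    {F : E → E' → ℝ} {G : E → ℝ} (hF : Measurable (Function.uncurry F)) (hF0 : ∀ u w, 0 ≤ F u w)
    (hFi : ∀ u, Integrable (fun ω => F u (W ω)) μ)
    (hFG : ∀ u, ∫ ω, F u (W ω) ∂μ ≤ G u)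
    (hG : Integrable (fun ω => G (U ω)) μ) :
    Integrable (fun ω => F (U ω) (W ω)) μ ∧ ∫ ω, F (U ω) (W ω) ∂μ ≤ ∫ ω, G (U ω) ∂μ := by
  have hG0 : ∀ u, 0 ≤ G u := fun u => (integral_nonneg fun ω => hF0 u _).trans (hFG u)
  have hm : Measurable fun ω => F (U ω) (W ω) := hF.comp (hU.prodMk hW)
  have key : ∫⁻ ω, ENNReal.ofReal (F (U ω) (W ω)) ∂μ ≤ ∫⁻ ω, ENNReal.ofReal (G (U ω)) ∂μ := by
    have e1 : ∫⁻ ω, ENNReal.ofReal (F (U ω) (W ω)) ∂μ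
        = ∫⁻ z, ENNReal.ofReal (Function.uncurry F z) ∂(μ.map fun ω => (U ω, W ω)) := by
      rw [lintegral_map hF.ennreal_ofReal (hU.prodMk hW)]
      rfl
    rw [e1, (indepFun_iff_map_prod_eq_prod_map_map hU.aemeasurable hW.aemeasurable).1 h]
    have := Measure.isProbabilityMeasure_map (μ := μ) hU.aemeasurable
    have := Measure.isProbabilityMeasure_map (μ := μ) hW.aemeasurable
    rw [lintegral_prod _ hF.ennreal_ofReal.aemeasurable,
      lintegral_map hF.ennreal_ofReal.lintegral_prod_right' hU]
    refine lintegral_mono fun ω => ?_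
    have hFu : Measurable fun y => ENNReal.ofReal (Function.uncurry F (U ω, y)) :=
      hF.ennreal_ofReal.comp measurable_prodMk_left
    rw [lintegral_map hFu hW]
    change ∫⁻ a, ENNReal.ofReal (F (U ω) (W a)) ∂μ ≤ _
    rw [← ofReal_integral_eq_lintegral_ofReal (hFi _) (ae_of_all _ fun a => hF0 _ _)]
    exact ENNReal.ofReal_le_ofReal (hFG _)
  have hi : Integrable (fun ω => F (U ω) (W ω)) μ := by
    refine ⟨hm.aestronglyMeasurable, ?_⟩
    rw [hasFiniteIntegral_iff_ofReal (ae_of_all _ fun ω => hF0 _ _)]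
    refine key.trans_lt ?_
    rw [← hasFiniteIntegral_iff_ofReal (ae_of_all _ fun ω => hG0 _)]
    exact hG.2
  refine ⟨hi, ?_⟩
  rw [integral_eq_lintegral_of_nonneg_ae (ae_of_all _ fun ω => hF0 _ _) hi.1,
    integral_eq_lintegral_of_nonneg_ae (ae_of_all _ fun ω => hG0 _) hG.1]
  refine ENNReal.toReal_mono ?_ key
  have := hG.2
  rw [hasFiniteIntegral_iff_ofReal (ae_of_all _ fun ω => hG0 _)] at this
  exact this.ne

theorem integrable_norm_rpow_of_le {Ω E : Type*} [MeasurableSpace Ω] [NormedAddCommGroup E]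
    {μ : Measure Ω} [IsFiniteMeasure μ] {X : Ω → E} (hX : AEStronglyMeasurable X μ) {r p : ℝ}
    (hr : 0 ≤ r) (hrp : r ≤ p) (h : Integrable (fun ω => ‖X ω‖ ^ p) μ) :
    Integrable (fun ω => ‖X ω‖ ^ r) μ := by
  refine Integrable.mono' (h.add (integrable_const (1 : ℝ)))
    (hX.norm.aemeasurable.pow_const r).aestronglyMeasurable (ae_of_all _ fun ω => ?_)
  have hn := norm_nonneg (X ω)
  rw [Real.norm_of_nonneg (by positivity)]
  change _ ≤ ‖X ω‖ ^ p + 1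
  rcases le_total ‖X ω‖ 1 with h1 | h1
  · have := Real.rpow_le_one hn h1 hr
    have : 0 ≤ ‖X ω‖ ^ p := by positivity
    linarith
  · have := Real.rpow_le_rpow_of_exponent_le h1 hrp
    linarith

/-- One-sided moment bound for a sum of independent nonnegative variables above a multiple
`1 + α > 1` of its mean. The surplus `α` acts as a negative drift, which absorbs all terms except
the sum of the individual moments. -/
theorem exists_integral_max_sum_sub_rpow_le.{u, w} {s α : ℝ} (hs : 1 ≤ s) (hα : 0 < α) :
    ∃ C : ℝ, 1 ≤ C ∧ ∀ {Ω : Type u} [MeasurableSpace Ω] (μ : Measure Ω) [IsProbabilityMeasure μ]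
      {κ : Type w} (ξ : κ → Ω → ℝ), (∀ i, Measurable (ξ i)) → iIndepFun ξ μ →
      (∀ i ω, 0 ≤ ξ i ω) → (∀ i, Integrable (fun ω => ξ i ω ^ s) μ) → ∀ A : Finset κ,
      Integrable (fun ω => max (∑ i ∈ A, ξ i ω - (1 + α) * ∑ i ∈ A, ∫ ω, ξ i ω ∂μ) 0 ^ s) μ ∧
      ∫ ω, max (∑ i ∈ A, ξ i ω - (1 + α) * ∑ i ∈ A, ∫ ω, ξ i ω ∂μ) 0 ^ s ∂μ
        ≤ C * ∑ i ∈ A, ∫ ω, ξ i ω ^ s ∂μ := by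
  classical
  obtain ⟨C, hC1, hC⟩ := exists_add_rpow_le hs hα
  refine ⟨C, hC1, fun {Ω} _ μ _ {κ} ξ hξ hind hnn hint A => ?_⟩
  have hint1 : ∀ i, Integrable (ξ i) μ := fun i => by
    have := integrable_norm_rpow_of_le (μ := μ) (hξ i).aestronglyMeasurable (r := 1) (p := s)
      zero_le_one hs (by simpa [Real.norm_of_nonneg (hnn i _)] using hint i)
    simpa [Real.norm_of_nonneg (hnn i _)] using this
  -- one step from a deterministic position `t`: below the drift `(1 + α) m` only `ξ ^ s` is
  -- left, and above it the drift compensates the linear term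
  have step : ∀ (i : κ) (t : ℝ),
      Integrable (fun ω => max (t + ξ i ω - (1 + α) * ∫ ω, ξ i ω ∂μ) 0 ^ s) μ ∧
      ∫ ω, max (t + ξ i ω - (1 + α) * ∫ ω, ξ i ω ∂μ) 0 ^ s ∂μ
        ≤ max t 0 ^ s + C * ∫ ω, ξ i ω ^ s ∂μ := by
    intro i t
    set m := ∫ ω, ξ i ω ∂μ with hm
    have hm0 : 0 ≤ m := integral_nonneg (hnn i)
    have hw0 : 0 ≤ (1 + α) * m := by positivity
    have hmeas : AEStronglyMeasurable (fun ω => max (t + ξ i ω - (1 + α) * m) 0 ^ s) μ :=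
      ((((hξ i).const_add t).sub_const _).max measurable_const).pow_const s
        |>.aestronglyMeasurable
    rcases le_total t ((1 + α) * m) with h | h
    · have hle : ∀ ω, max (t + ξ i ω - (1 + α) * m) 0 ^ s ≤ ξ i ω ^ s := fun ω =>
        Real.rpow_le_rpow (le_max_right _ _) (max_le (by linarith) (hnn i ω)) (by linarith)
      have hi : Integrable (fun ω => max (t + ξ i ω - (1 + α) * m) 0 ^ s) μ :=
        (hint i).mono' hmeas (ae_of_all _ fun ω => by
          rw [Real.norm_of_nonneg (by positivity)]; exact hle ω)
      refine ⟨hi, (integral_mono hi (hint i) hle).trans ?_⟩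
      have h0 : 0 ≤ ∫ ω, ξ i ω ^ s ∂μ := integral_nonneg fun ω => Real.rpow_nonneg (hnn i ω) s
      have : 0 ≤ max t 0 ^ s := by positivity
      nlinarith
    · set t' := t - (1 + α) * m with ht'
      have ht0 : 0 ≤ t' := by linarith
      have hle : ∀ ω, max (t + ξ i ω - (1 + α) * m) 0 ^ s
          ≤ t' ^ s + (1 + α) * (s * t' ^ (s - 1)) * ξ i ω + C * ξ i ω ^ s := fun ω => by
        have h1 : max (t + ξ i ω - (1 + α) * m) 0 = t' + ξ i ω := by
          rw [max_eq_left (by linarith [hnn i ω])]; ring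
        rw [h1]
        linarith [hC t' (ξ i ω) ht0 (hnn i ω)]
      have hi1 : Integrable (fun ω => t' ^ s + (1 + α) * (s * t' ^ (s - 1)) * ξ i ω) μ :=
        (integrable_const _).add ((hint1 i).const_mul _)
      have hi2 : Integrable (fun ω => t' ^ s + (1 + α) * (s * t' ^ (s - 1)) * ξ i ω
          + C * ξ i ω ^ s) μ := hi1.add ((hint i).const_mul _)
      have hi : Integrable (fun ω => max (t + ξ i ω - (1 + α) * m) 0 ^ s) μ :=
        hi2.mono' hmeas (ae_of_all _ fun ω => by
          rw [Real.norm_of_nonneg (by positivity)]; exact hle ω)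
      refine ⟨hi, (integral_mono hi hi2 hle).trans ?_⟩
      rw [integral_add hi1 ((hint i).const_mul _),
        integral_add (integrable_const _) ((hint1 i).const_mul _), integral_const_mul,
        integral_const_mul, ← hm]
      have h2 := rpow_tangent_le (s := s) (x := t') (y := t) hs ht0 (by linarith)
      rw [max_eq_left (by linarith : 0 ≤ t)]
      have h3 : t - t' = (1 + α) * m := by rw [ht']; ring
      rw [h3] at h2
      simp only [integral_const, probReal_univ, smul_eq_mul, one_mul]
      nlinarith
  induction A using Finset.induction_on with
  | empty => simp [Real.zero_rpow (show s ≠ 0 by linarith)]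
  | insert a A ha ih =>
    have hind' : IndepFun (fun ω => ∑ i ∈ A, ξ i ω) (ξ a) μ := by
      have := hind.indepFun_finsetSum_of_notMem hξ ha
      convert this using 1
      ext ω; simp
    set c := (1 + α) * ∑ i ∈ A, ∫ ω, ξ i ω ∂μ
    have hmU : Measurable fun ω => ∑ i ∈ A, ξ i ω - c :=
      (Finset.measurable_sum A fun i _ => hξ i).sub_const c
    have hindU : IndepFun (fun ω => ∑ i ∈ A, ξ i ω - c) (ξ a) μ :=
      hind'.comp (φ := fun y => y - c) (ψ := id) (measurable_id.sub_const c) measurable_id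
    have hF : Measurable (Function.uncurry fun (t x : ℝ) =>
        max (t + x - (1 + α) * ∫ ω, ξ a ω ∂μ) 0 ^ s) :=
      (((measurable_fst.add measurable_snd).sub_const _).max measurable_const).pow_const s
    have := integrable_and_integral_le_of_indepFun (μ := μ) hmU (hξ a) hindU
      (F := fun t x => max (t + x - (1 + α) * ∫ ω, ξ a ω ∂μ) 0 ^ s)
      (G := fun t => max t 0 ^ s + C * ∫ ω, ξ a ω ^ s ∂μ) hF (fun _ _ => by positivity)
      (fun t => (step a t).1) (fun t => (step a t).2) (ih.1.add (integrable_const _))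
    have e : ∀ ω, ∑ i ∈ insert a A, ξ i ω - (1 + α) * ∑ i ∈ insert a A, ∫ ω, ξ i ω ∂μ
        = ∑ i ∈ A, ξ i ω - c + ξ a ω - (1 + α) * ∫ ω, ξ a ω ∂μ := fun ω => by
      rw [Finset.sum_insert ha, Finset.sum_insert ha]; ring
    simp only [e]
    refine ⟨this.1, this.2.trans ?_⟩
    rw [integral_add ih.1 (integrable_const _), Finset.sum_insert ha]
    simp only [integral_const, probReal_univ, smul_eq_mul, one_mul]
    linarith [ih.2]

/-- Rosenthal's inequality in a Hilbert space, with the variance bounded by the square of a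
scale `x`. -/
theorem exists_integral_norm_sum_rpow_le.{u, v, w} {p : ℝ} (hp : 2 ≤ p) :
    ∃ C : ℝ, 0 < C ∧ ∀ {H : Type v} [NormedAddCommGroup H] [InnerProductSpace ℝ H]
      [CompleteSpace H] [MeasurableSpace H] [BorelSpace H] [SecondCountableTopology H]
      {Ω : Type u} [MeasurableSpace Ω] (μ : Measure Ω)
      [IsProbabilityMeasure μ] {κ : Type w} (X : κ → Ω → H) (x : ℝ), (∀ i, Measurable (X i)) →
      iIndepFun X μ → (∀ i, ∫ ω, X i ω ∂μ = 0) → (∀ i, Integrable (fun ω => ‖X i ω‖ ^ p) μ) →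
      0 < x → ∀ A : Finset κ, ∑ i ∈ A, ∫ ω, ‖X i ω‖ ^ 2 ∂μ ≤ x ^ 2 →
      Integrable (fun ω => ‖∑ i ∈ A, X i ω‖ ^ p) μ ∧
      ∫ ω, ‖∑ i ∈ A, X i ω‖ ^ p ∂μ ≤ C * (x ^ p + ∑ i ∈ A, ∫ ω, ‖X i ω‖ ^ p ∂μ) := by
  classical
  obtain ⟨c, hc0, hc⟩ := exists_norm_add_rpow_le hp
  set C := c ^ (p / 2) + c + 1 with hCdef
  have hCc : c ≤ C := by have : 0 ≤ c ^ (p / 2) := by positivity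
                         linarith
  have hC0 : 0 < C := by positivity
  refine ⟨Real.exp 1 * C, by positivity, ?_⟩
  intro H _ _ _ _ _ _ Ω _ μ _ κ X x hX hind hcen hint hx A hA
  have hint2 : ∀ i, Integrable (fun ω => ‖X i ω‖ ^ 2) μ := fun i => by
    have := integrable_norm_rpow_of_le (μ := μ) (hX i).aestronglyMeasurable (r := 2) (p := p)
      zero_le_two hp (hint i)
    simpa using this
  have hint1 : ∀ i, Integrable (X i) μ := fun i => by
    have := integrable_norm_rpow_of_le (μ := μ) (hX i).aestronglyMeasurable (r := 1) (p := p)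
      zero_le_one (by linarith) (hint i)
    simp only [Real.rpow_one] at this
    exact (integrable_norm_iff (hX i).aestronglyMeasurable).1 this
  set V : κ → ℝ := fun i => ∫ ω, ‖X i ω‖ ^ 2 ∂μ with hV
  set β : κ → ℝ := fun i => ∫ ω, ‖X i ω‖ ^ p ∂μ with hβ
  have hV0 : ∀ i, 0 ≤ V i / x ^ 2 := fun i =>
    div_nonneg (integral_nonneg fun ω => sq_nonneg _) (sq_nonneg x)
  have hβ0 : ∀ i, 0 ≤ β i := fun i => integral_nonneg fun ω => Real.rpow_nonneg (norm_nonneg _) _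
  have step : ∀ (i : κ) (t : H), Integrable (fun ω => ‖t + X i ω‖ ^ p) μ ∧
      ∫ ω, ‖t + X i ω‖ ^ p ∂μ
        ≤ (1 + V i / x ^ 2) * ‖t‖ ^ p + (C * x ^ p * (V i / x ^ 2) + C * β i) := by
    intro i t
    have hi0 : Integrable (fun ω => ‖t‖ ^ p + p * ‖t‖ ^ (p - 2) * inner ℝ t (X i ω)) μ :=
      (integrable_const _).add (((hint1 i).const_inner t).const_mul _)
    have hi1 : Integrable (fun ω => ‖t‖ ^ (p - 2) * ‖X i ω‖ ^ 2 + ‖X i ω‖ ^ p) μ :=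
      ((hint2 i).const_mul _).add (hint i)
    have hi2 : Integrable (fun ω => ‖t‖ ^ p + p * ‖t‖ ^ (p - 2) * inner ℝ t (X i ω)
        + c * (‖t‖ ^ (p - 2) * ‖X i ω‖ ^ 2 + ‖X i ω‖ ^ p)) μ := hi0.add (hi1.const_mul _)
    have hi : Integrable (fun ω => ‖t + X i ω‖ ^ p) μ :=
      hi2.mono' ((((hX i).const_add t).norm.pow_const p).aestronglyMeasurable)
        (ae_of_all _ fun ω => by
          rw [Real.norm_of_nonneg (by positivity)]; exact hc t (X i ω))
    refine ⟨hi, (integral_mono hi hi2 fun ω => hc t (X i ω)).trans ?_⟩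
    rw [integral_add hi0 (hi1.const_mul _),
      integral_add (integrable_const _) (((hint1 i).const_inner t).const_mul _),
      integral_const_mul, integral_const_mul, integral_add ((hint2 i).const_mul _) (hint i),
      integral_const_mul, integral_inner (hint1 i), hcen i, inner_zero_right]
    simp only [integral_const, probReal_univ, smul_eq_mul, one_mul]
    have h1 := mul_le_mul_of_nonneg_right
      (rpow_sub_two_mul_le hp hc0 (norm_nonneg t) hx.le) (hV0 i)
    have h2 : c * ‖t‖ ^ (p - 2) * x ^ 2 * (V i / x ^ 2) = c * ‖t‖ ^ (p - 2) * V i := by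
      field_simp
    rw [h2] at h1
    have h3 : c ^ (p / 2) * (x ^ p * (V i / x ^ 2)) ≤ C * (x ^ p * (V i / x ^ 2)) := by
      have := hV0 i
      gcongr
      linarith
    have h4 : c * β i ≤ C * β i := mul_le_mul_of_nonneg_right hCc (hβ0 i)
    change ‖t‖ ^ p + p * ‖t‖ ^ (p - 2) * 0 + c * (‖t‖ ^ (p - 2) * V i + β i) ≤ _
    linarith
  -- a discrete Grönwall argument
  have main : ∀ A : Finset κ, Integrable (fun ω => ‖∑ i ∈ A, X i ω‖ ^ p) μ ∧
      ∫ ω, ‖∑ i ∈ A, X i ω‖ ^ p ∂μ ≤ Real.exp (∑ i ∈ A, V i / x ^ 2) *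
        (C * x ^ p * ∑ i ∈ A, V i / x ^ 2 + C * ∑ i ∈ A, β i) := by
    intro A
    induction A using Finset.induction_on with
    | empty => simp [Real.zero_rpow (show p ≠ 0 by linarith)]
    | insert a A ha ih =>
      have hindU : IndepFun (fun ω => ∑ i ∈ A, X i ω) (X a) μ := by
        have := hind.indepFun_finsetSum_of_notMem hX ha
        convert this using 1
        ext ω; simp
      have hmU : Measurable fun ω => ∑ i ∈ A, X i ω := Finset.measurable_sum A fun i _ => hX i
      have hF : Measurable (Function.uncurry fun (t y : H) => ‖t + y‖ ^ p) :=
        (measurable_fst.add measurable_snd).norm.pow_const p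
      have := integrable_and_integral_le_of_indepFun (μ := μ) hmU (hX a) hindU
        (F := fun t y => ‖t + y‖ ^ p)
        (G := fun t => (1 + V a / x ^ 2) * ‖t‖ ^ p + (C * x ^ p * (V a / x ^ 2) + C * β a))
        hF (fun _ _ => by positivity)
        (fun t => (step a t).1) (fun t => (step a t).2)
        ((ih.1.const_mul _).add (integrable_const _))
      have e : ∀ ω, ∑ i ∈ insert a A, X i ω = ∑ i ∈ A, X i ω + X a ω := fun ω => by
        rw [Finset.sum_insert ha, add_comm]
      simp only [e]
      refine ⟨this.1, this.2.trans ?_⟩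
      rw [integral_add (ih.1.const_mul _) (integrable_const _), integral_const_mul,
        Finset.sum_insert ha, Finset.sum_insert ha]
      simp only [integral_const, probReal_univ, smul_eq_mul, one_mul]
      set v := V a / x ^ 2
      set s := ∑ i ∈ A, V i / x ^ 2 with hs
      have hv : 0 ≤ v := hV0 a
      have hs0 : 0 ≤ s := Finset.sum_nonneg fun i _ => hV0 i
      have hb0 : 0 ≤ ∑ i ∈ A, β i := Finset.sum_nonneg fun i _ => hβ0 i
      have hβa := hβ0 a
      have h1 : (1 + v) * ∫ ω, ‖∑ i ∈ A, X i ω‖ ^ p ∂μ ≤ Real.exp v * (Real.exp s *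
          (C * x ^ p * s + C * ∑ i ∈ A, β i)) := by
        refine mul_le_mul (by linarith [Real.add_one_le_exp v]) ih.2
          (integral_nonneg fun ω => by positivity) (by positivity)
      have h2 : C * x ^ p * v + C * β a ≤ Real.exp (v + s) * (C * x ^ p * v + C * β a) :=
        le_mul_of_one_le_left (by positivity) (Real.one_le_exp (by positivity))
      rw [← mul_assoc, ← Real.exp_add] at h1
      linarith
  refine ⟨(main A).1, (main A).2.trans ?_⟩
  have hs1 : ∑ i ∈ A, V i / x ^ 2 ≤ 1 := by
    rw [← Finset.sum_div, div_le_one (by positivity)]; exact hA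
  have hs0 : 0 ≤ ∑ i ∈ A, V i / x ^ 2 := Finset.sum_nonneg fun i _ => hV0 i
  have hb0 : 0 ≤ ∑ i ∈ A, β i := Finset.sum_nonneg fun i _ => hβ0 i
  calc Real.exp (∑ i ∈ A, V i / x ^ 2) * (C * x ^ p * ∑ i ∈ A, V i / x ^ 2 + C * ∑ i ∈ A, β i)
      ≤ Real.exp 1 * (C * x ^ p * 1 + C * ∑ i ∈ A, β i) := by gcongr
    _ = _ := by ring

/-! ### Decoupling and quadratic forms -/

/-- Averaging over random signs, the signs being encoded by the subset `A` where they are `+1`. -/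
theorem sum_powerset_norm_sq_sum_sub {H κ : Type*} [NormedAddCommGroup H] [InnerProductSpace ℝ H]
    [DecidableEq κ] (x : κ → H) (s : Finset κ) :
    ∑ A ∈ s.powerset, ‖∑ i ∈ A, x i - ∑ i ∈ s \ A, x i‖ ^ 2
      = 2 ^ s.card * ∑ i ∈ s, ‖x i‖ ^ 2 := by
  induction s using Finset.induction_on with
  | empty => simp
  | insert a s ha ih =>
    rw [Finset.sum_powerset_insert ha, ← Finset.sum_add_distrib, Finset.card_insert_of_notMem ha,
      Finset.sum_insert ha]
    have h : ∀ A ∈ s.powerset,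
        ‖∑ i ∈ A, x i - ∑ i ∈ insert a s \ A, x i‖ ^ 2
          + ‖∑ i ∈ insert a A, x i - ∑ i ∈ insert a s \ insert a A, x i‖ ^ 2
        = 2 * ‖∑ i ∈ A, x i - ∑ i ∈ s \ A, x i‖ ^ 2 + 2 * ‖x a‖ ^ 2 := by
      intro A hA
      have haA : a ∉ A := fun h => ha (Finset.mem_powerset.1 hA h)
      have h1 : insert a s \ A = insert a (s \ A) := Finset.insert_sdiff_of_notMem _ haA
      have h2 : insert a s \ insert a A = s \ A := by
        ext i; simp only [Finset.mem_sdiff, Finset.mem_insert]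
        constructor
        · rintro ⟨h | h, h'⟩
          · exact absurd (Or.inl h) h'
          · exact ⟨h, fun h'' => h' (Or.inr h'')⟩
        · rintro ⟨h, h'⟩
          refine ⟨Or.inr h, ?_⟩
          rintro (rfl | h'')
          · exact ha h
          · exact h' h''
      rw [h1, h2, Finset.sum_insert haA, Finset.sum_insert (by simp [ha])]
      set u := ∑ i ∈ A, x i
      set w := ∑ i ∈ s \ A, x i
      have e1 : u - (x a + w) = (u - w) - x a := by abel
      have e2 : x a + u - w = (u - w) + x a := by abel
      rw [e1, e2, norm_add_sq_real, norm_sub_sq_real]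
      ring
    rw [Finset.sum_congr rfl h, Finset.sum_add_distrib, ← Finset.mul_sum, ih, Finset.sum_const,
      Finset.card_powerset, nsmul_eq_mul]
    push_cast
    ring

/-- The off-diagonal part of `‖∑ i, x i‖ ^ 2` is the average over all `A` of
`4 ⟪∑ i ∈ A, x i, ∑ i ∉ A, x i⟫`, in which the two sums share no variable. -/
theorem norm_sq_sum_sub_sum_norm_sq {H κ : Type*} [NormedAddCommGroup H] [InnerProductSpace ℝ H]
    [DecidableEq κ] [Fintype κ] (x : κ → H) :
    ‖∑ i, x i‖ ^ 2 - ∑ i, ‖x i‖ ^ 2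
      = ∑ A : Finset κ, ((2 : ℝ) ^ Fintype.card κ)⁻¹ *
        (4 * inner ℝ (∑ i ∈ A, x i) (∑ i ∈ Aᶜ, x i)) := by
  have h := sum_powerset_norm_sq_sum_sub x Finset.univ
  rw [Finset.powerset_univ, Finset.card_univ] at h
  have h1 : ∀ A : Finset κ, 4 * inner ℝ (∑ i ∈ A, x i) (∑ i ∈ Aᶜ, x i)
      = ‖∑ i, x i‖ ^ 2 - ‖∑ i ∈ A, x i - ∑ i ∈ Finset.univ \ A, x i‖ ^ 2 := by
    intro A
    rw [← Finset.sum_add_sum_compl A x, ← Finset.compl_eq_univ_sdiff, norm_add_sq_real,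
      norm_sub_sq_real]
    ring
  rw [← Finset.mul_sum, Finset.sum_congr rfl fun A _ => h1 A, Finset.sum_sub_distrib, h,
    Finset.sum_const, Finset.card_univ, Fintype.card_finset, nsmul_eq_mul]
  push_cast
  field_simp

/-- Moment bound for the off-diagonal part of `‖∑ i, X i‖ ^ 2`. The weak variance `τ ^ 2`, rather
than `x ^ 2`, controls one of the two factors, since after decoupling one sum acts as a fixed
direction on the other. -/
theorem exists_integral_abs_offDiag_rpow_le.{u, v, w} {p : ℝ} (hp : 2 ≤ p) :
    ∃ C : ℝ, 0 < C ∧ ∀ {H : Type v} [NormedAddCommGroup H] [InnerProductSpace ℝ H]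
      [CompleteSpace H] [MeasurableSpace H] [BorelSpace H] [SecondCountableTopology H]
      {Ω : Type u} [MeasurableSpace Ω] (μ : Measure Ω)
      [IsProbabilityMeasure μ] {κ : Type w} [Fintype κ] (X : κ → Ω → H) (x τ B : ℝ),
      (∀ i, Measurable (X i)) → iIndepFun X μ → (∀ i, ∫ ω, X i ω ∂μ = 0) →
      (∀ i, Integrable (fun ω => ‖X i ω‖ ^ p) μ) →
      0 < x → ∑ i, ∫ ω, ‖X i ω‖ ^ 2 ∂μ ≤ x ^ 2 →
      0 < τ → (∀ y : H, ∑ i, ∫ ω, inner ℝ y (X i ω) ^ 2 ∂μ ≤ τ ^ 2 * ‖y‖ ^ 2) →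
      τ ^ p ≤ B → ∑ i, ∫ ω, ‖X i ω‖ ^ p ∂μ ≤ B →
      Integrable (fun ω => |‖∑ i, X i ω‖ ^ 2 - ∑ i, ‖X i ω‖ ^ 2| ^ p) μ ∧
      ∫ ω, |‖∑ i, X i ω‖ ^ 2 - ∑ i, ‖X i ω‖ ^ 2| ^ p ∂μ ≤ C * ((x ^ p + B) * B) := by
  classical
  obtain ⟨C₁, hC₁, hros⟩ := exists_integral_norm_sum_rpow_le.{u, v, w} hp
  obtain ⟨C₂, hC₂, hrosR⟩ := exists_integral_norm_sum_rpow_le.{u, 0, w} hp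
  refine ⟨4 ^ p * (2 * C₂ * C₁), by positivity, ?_⟩
  intro H _ _ _ _ _ _ Ω _ μ _ κ _ X x τ B hX hind hcen hint hx hVx hτ hτX hτB hB
  have hB0 : 0 < B := lt_of_lt_of_le (by positivity) hτB
  have hsub : ∀ (g : κ → ℝ), (∀ i, 0 ≤ g i) → ∀ A : Finset κ, ∑ i ∈ A, g i ≤ ∑ i, g i :=
    fun g hg A => Finset.sum_le_sum_of_subset_of_nonneg (Finset.subset_univ A) fun i _ _ => hg i
  have hint1 : ∀ i, Integrable (X i) μ := fun i => by
    have := integrable_norm_rpow_of_le (μ := μ) (hX i).aestronglyMeasurable (r := 1) (p := p)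
      zero_le_one (by linarith) (hint i)
    simp only [Real.rpow_one] at this
    exact (integrable_norm_iff (hX i).aestronglyMeasurable).1 this
  have hmS : ∀ A : Finset κ, Measurable fun ω => ∑ i ∈ A, X i ω := fun A =>
    Finset.measurable_sum A fun i _ => hX i
  -- the sum of the projections on a fixed direction `y`
  have hdir : ∀ (A : Finset κ) (y : H),
      Integrable (fun ω => |inner ℝ y (∑ i ∈ A, X i ω)| ^ p) μ ∧
      ∫ ω, |inner ℝ y (∑ i ∈ A, X i ω)| ^ p ∂μ ≤ 2 * C₂ * B * ‖y‖ ^ p := by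
    intro A y
    rcases eq_or_ne y 0 with rfl | hy
    · simp [Real.zero_rpow (show p ≠ 0 by linarith)]
    have hy0 : 0 < ‖y‖ := norm_pos_iff.2 hy
    have hbd : ∀ i ω, ‖(inner ℝ y (X i ω) : ℝ)‖ ^ p ≤ ‖y‖ ^ p * ‖X i ω‖ ^ p := fun i ω => by
      rw [← Real.mul_rpow hy0.le (norm_nonneg _)]
      exact Real.rpow_le_rpow (norm_nonneg _) (norm_inner_le_norm _ _) (by linarith)
    have hmY : ∀ i, Measurable fun ω => (inner ℝ y (X i ω) : ℝ) := fun i =>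
      measurable_const.inner (hX i)
    have hiY : ∀ i, Integrable (fun ω => ‖(inner ℝ y (X i ω) : ℝ)‖ ^ p) μ := fun i =>
      ((hint i).const_mul (‖y‖ ^ p)).mono' ((hmY i).norm.pow_const p).aestronglyMeasurable
        (ae_of_all _ fun ω => by
          rw [Real.norm_of_nonneg (by positivity)]; exact hbd i ω)
    have := hrosR μ (fun i ω => (inner ℝ y (X i ω) : ℝ)) (τ * ‖y‖) hmY
      (hind.comp (fun _ h => (inner ℝ y h : ℝ)) fun i => measurable_const.inner measurable_id)
      (fun i => by rw [integral_inner (hint1 i), hcen i, inner_zero_right]) hiY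
      (by positivity) A (by
        simp only [Real.norm_eq_abs, sq_abs]
        rw [mul_pow]
        exact (hsub _ (fun i => integral_nonneg fun ω => sq_nonneg _) A).trans (hτX y))
    simp only [inner_sum, Real.norm_eq_abs] at this hbd hiY ⊢
    refine ⟨this.1, this.2.trans ?_⟩
    have h1 : ∑ i ∈ A, ∫ ω, |(inner ℝ y (X i ω) : ℝ)| ^ p ∂μ ≤ ‖y‖ ^ p * B := by
      calc ∑ i ∈ A, ∫ ω, |(inner ℝ y (X i ω) : ℝ)| ^ p ∂μ
          ≤ ∑ i, ∫ ω, |(inner ℝ y (X i ω) : ℝ)| ^ p ∂μ :=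
            hsub _ (fun i => integral_nonneg fun ω => by positivity) A
        _ ≤ ∑ i, ‖y‖ ^ p * ∫ ω, ‖X i ω‖ ^ p ∂μ := Finset.sum_le_sum fun i _ => by
            rw [← integral_const_mul]
            exact integral_mono (hiY i) ((hint i).const_mul _) (hbd i)
        _ ≤ ‖y‖ ^ p * B := by rw [← Finset.mul_sum]; gcongr
    have h2 : (τ * ‖y‖) ^ p ≤ ‖y‖ ^ p * B := by
      rw [Real.mul_rpow hτ.le hy0.le, mul_comm]; gcongr
    calc C₂ * ((τ * ‖y‖) ^ p + ∑ i ∈ A, ∫ ω, |(inner ℝ y (X i ω) : ℝ)| ^ p ∂μ)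
        ≤ C₂ * (‖y‖ ^ p * B + ‖y‖ ^ p * B) := by gcongr
      _ = _ := by ring
  have hpair : ∀ A : Finset κ,
      Integrable (fun ω => |inner ℝ (∑ i ∈ A, X i ω) (∑ i ∈ Aᶜ, X i ω)| ^ p) μ ∧
      ∫ ω, |inner ℝ (∑ i ∈ A, X i ω) (∑ i ∈ Aᶜ, X i ω)| ^ p ∂μ
        ≤ 2 * C₂ * C₁ * ((x ^ p + B) * B) := by
    intro A
    have hA := hros μ X x hX hind hcen hint hx A
      ((hsub _ (fun i => integral_nonneg fun ω => sq_nonneg _) A).trans hVx)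
    have hindA : IndepFun (fun ω => ∑ i ∈ A, X i ω) (fun ω => ∑ i ∈ Aᶜ, X i ω) μ := by
      have h := hind.indepFun_finset A Aᶜ disjoint_compl_right hX
      have h' := h.comp (φ := fun f : A → H => ∑ i, f i)
        (ψ := fun f : (Aᶜ : Finset κ) → H => ∑ i, f i)
        (Finset.measurable_sum _ fun i _ => measurable_pi_apply i)
        (Finset.measurable_sum _ fun i _ => measurable_pi_apply i)
      convert h' using 1
      · ext ω; exact (Finset.sum_coe_sort A fun i => X i ω).symm
      · ext ω; exact (Finset.sum_coe_sort Aᶜ fun i => X i ω).symm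
    have hF : Measurable (Function.uncurry fun (y z : H) => |(inner ℝ y z : ℝ)| ^ p) := by
      have h : Measurable fun a : H × H => (inner ℝ a.1 a.2 : ℝ) :=
        measurable_fst.inner measurable_snd
      exact (measurable_norm.comp h).pow_const p
    have := integrable_and_integral_le_of_indepFun (μ := μ) (hmS A) (hmS Aᶜ) hindA
      (F := fun y z => |(inner ℝ y z : ℝ)| ^ p) (G := fun y => 2 * C₂ * B * ‖y‖ ^ p) hF
      (fun _ _ => by positivity) (fun y => (hdir _ y).1) (fun y => (hdir _ y).2)
      (hA.1.const_mul _)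
    refine ⟨this.1, this.2.trans ?_⟩
    rw [integral_const_mul]
    have h1 : ∑ i ∈ A, ∫ ω, ‖X i ω‖ ^ p ∂μ ≤ B :=
      (hsub _ (fun i => integral_nonneg fun ω => by positivity) A).trans hB
    calc 2 * C₂ * B * ∫ ω, ‖∑ i ∈ A, X i ω‖ ^ p ∂μ
        ≤ 2 * C₂ * B * (C₁ * (x ^ p + ∑ i ∈ A, ∫ ω, ‖X i ω‖ ^ p ∂μ)) := by gcongr; exact hA.2
      _ ≤ 2 * C₂ * B * (C₁ * (x ^ p + B)) := by gcongr
      _ = _ := by ring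
  set W : ℝ := ((2 : ℝ) ^ Fintype.card κ)⁻¹ with hW
  have hW0 : 0 < W := by positivity
  have hW1 : ∑ _A : Finset κ, W = 1 := by
    rw [Finset.sum_const, Finset.card_univ, Fintype.card_finset, nsmul_eq_mul, hW]
    push_cast
    exact mul_inv_cancel₀ (by positivity)
  -- Jensen's inequality for the average over `A`
  have hjen : ∀ ω, |‖∑ i, X i ω‖ ^ 2 - ∑ i, ‖X i ω‖ ^ 2| ^ p
      ≤ ∑ A : Finset κ, W * 4 ^ p * |inner ℝ (∑ i ∈ A, X i ω) (∑ i ∈ Aᶜ, X i ω)| ^ p := by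
    intro ω
    rw [norm_sq_sum_sub_sum_norm_sq fun i => X i ω]
    calc _ ≤ (∑ A : Finset κ, W * |4 * inner ℝ (∑ i ∈ A, X i ω) (∑ i ∈ Aᶜ, X i ω)|) ^ p := by
          refine Real.rpow_le_rpow (abs_nonneg _) ?_ (by linarith)
          refine (Finset.abs_sum_le_sum_abs _ _).trans (Finset.sum_le_sum fun A _ => ?_)
          rw [abs_mul, abs_of_pos hW0]
      _ ≤ ∑ A : Finset κ, W * |4 * inner ℝ (∑ i ∈ A, X i ω) (∑ i ∈ Aᶜ, X i ω)| ^ p :=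
          Real.rpow_arith_mean_le_arith_mean_rpow _ _ _ (fun _ _ => hW0.le) hW1
            (fun _ _ => abs_nonneg _) (by linarith)
      _ = _ := Finset.sum_congr rfl fun A _ => by
          rw [abs_mul, Real.mul_rpow (abs_nonneg _) (abs_nonneg _),
            abs_of_pos (by norm_num : (0 : ℝ) < 4)]
          ring
  have hi2 : Integrable (fun ω => ∑ A : Finset κ,
      W * 4 ^ p * |inner ℝ (∑ i ∈ A, X i ω) (∑ i ∈ Aᶜ, X i ω)| ^ p) μ :=
    integrable_finsetSum _ fun A _ => (hpair A).1.const_mul _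
  have hmeas : Measurable fun ω => |‖∑ i, X i ω‖ ^ 2 - ∑ i, ‖X i ω‖ ^ 2| ^ p :=
    (measurable_norm.comp (((hmS Finset.univ).norm.pow_const 2).sub
      (Finset.measurable_sum _ fun i _ => (hX i).norm.pow_const 2))).pow_const p
  have hi : Integrable (fun ω => |‖∑ i, X i ω‖ ^ 2 - ∑ i, ‖X i ω‖ ^ 2| ^ p) μ :=
    hi2.mono' hmeas.aestronglyMeasurable (ae_of_all _ fun ω => by
      rw [Real.norm_of_nonneg (by positivity)]; exact hjen ω)
  refine ⟨hi, (integral_mono hi hi2 hjen).trans ?_⟩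
  rw [integral_finsetSum _ fun A _ => (hpair A).1.const_mul _]
  calc ∑ A : Finset κ, ∫ ω, W * 4 ^ p * |inner ℝ (∑ i ∈ A, X i ω) (∑ i ∈ Aᶜ, X i ω)| ^ p ∂μ
      ≤ ∑ _A : Finset κ, W * (4 ^ p * (2 * C₂ * C₁ * ((x ^ p + B) * B))) :=
        Finset.sum_le_sum fun A _ => by
          rw [integral_const_mul, mul_assoc]
          gcongr
          exact (hpair A).2
    _ = _ := by rw [← Finset.sum_mul, hW1]; ring

/-- Moment bound for the excess of `‖∑ i, X i‖ ^ 2` over a multiple `1 + α > 1` of its mean. The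
diagonal part is handled by the one-sided bound for nonnegative variables and the off-diagonal
part by decoupling. -/
theorem exists_integral_max_norm_sq_sum_sub_rpow_le.{u, v, w} {α p q : ℝ} (hα : 0 < α) (hp : 2 ≤ p)
    (hq : 0 < q) (hqp : q ≤ p / 2) :
    ∃ C : ℝ, 0 < C ∧ ∀ {H : Type v} [NormedAddCommGroup H] [InnerProductSpace ℝ H]
      [CompleteSpace H] [MeasurableSpace H] [BorelSpace H] [SecondCountableTopology H]
      {Ω : Type u} [MeasurableSpace Ω] (μ : Measure Ω)
      [IsProbabilityMeasure μ] {κ : Type w} [Fintype κ] (X : κ → Ω → H) (S τ B : ℝ),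
      (∀ i, Measurable (X i)) → iIndepFun X μ → (∀ i, ∫ ω, X i ω ∂μ = 0) →
      (∀ i, Integrable (fun ω => ‖X i ω‖ ^ p) μ) →
      0 < S → ∑ i, ∫ ω, ‖X i ω‖ ^ 2 ∂μ = S →
      0 < τ → (∀ y : H, ∑ i, ∫ ω, inner ℝ y (X i ω) ^ 2 ∂μ ≤ τ ^ 2 * ‖y‖ ^ 2) →
      τ ^ p ≤ B → ∑ i, ∫ ω, ‖X i ω‖ ^ p ∂μ ≤ B →
      Integrable (fun ω => max (‖∑ i, X i ω‖ ^ 2 - (1 + α) * S) 0 ^ q) μ ∧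
      ∫ ω, max (‖∑ i, X i ω‖ ^ 2 - (1 + α) * S) 0 ^ q ∂μ ≤ C * (B * S ^ (q - p / 2)) := by
  set c := α / 4 with hc
  have hc0 : 0 < c := by positivity
  obtain ⟨C₁, hC₁, hdiag⟩ :=
    exists_integral_max_sum_sub_rpow_le.{u, w} (s := p / 2) (by linarith) hc0
  obtain ⟨C₂, hC₂, hoff⟩ := exists_integral_abs_offDiag_rpow_le.{u, v, w} hp
  refine ⟨2 ^ q * (c ^ (q - p / 2) * C₁ + ((2 * c) ^ (q - p) * (C₂ * 2)
    + (2 * c) ^ (q - p / 2) * (C₂ * 2 + 1))), by positivity, ?_⟩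
  intro H _ _ _ _ _ _ Ω _ μ _ κ _ X S τ B hX hind hcen hint hS hVS hτ hτX hτB hB
  have hB0 : 0 < B := lt_of_lt_of_le (by positivity) hτB
  have hsq : ∀ y : ℝ, 0 ≤ y → (y ^ 2) ^ (p / 2) = y ^ p := fun y hy => by
    rw [← Real.rpow_natCast, ← Real.rpow_mul hy]; congr 1; push_cast; ring
  have hoff' := hoff μ X (Real.sqrt S) τ B hX hind hcen hint (Real.sqrt_pos.2 hS)
    (by rw [Real.sq_sqrt hS.le, hVS]) hτ hτX hτB hB
  have hx : Real.sqrt S ^ p = S ^ (p / 2) := by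
    rw [← hsq _ (Real.sqrt_nonneg S), Real.sq_sqrt hS.le]
  rw [hx] at hoff'
  have hdiag' := hdiag μ (fun i ω => ‖X i ω‖ ^ 2) (fun i => (hX i).norm.pow_const 2)
    (hind.comp (fun _ h => ‖h‖ ^ 2) fun i => measurable_norm.pow_const 2)
    (fun i ω => sq_nonneg _) (fun i => by
      simpa only [hsq _ (norm_nonneg _)] using hint i) Finset.univ
  simp only [hsq _ (norm_nonneg _)] at hdiag'
  rw [hVS] at hdiag'
  set T : Ω → ℝ := fun ω => ∑ i, ‖X i ω‖ ^ 2 with hT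
  set R : Ω → ℝ := fun ω => ‖∑ i, X i ω‖ ^ 2 - ∑ i, ‖X i ω‖ ^ 2 with hR
  have hmS : Measurable fun ω => ∑ i, X i ω := Finset.measurable_sum _ fun i _ => hX i
  have hmT : Measurable T := Finset.measurable_sum _ fun i _ => (hX i).norm.pow_const 2
  have hmR : Measurable R := (hmS.norm.pow_const 2).sub hmT
  -- the off-diagonal part: the moment of order `p` if `B ≤ S ^ (p / 2)`, else that of order `p / 2`
  have hRq : ∃ G : Ω → ℝ, Integrable G μ ∧ (∀ ω, max (R ω - 2 * c * S) 0 ^ q ≤ G ω) ∧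
      ∫ ω, G ω ∂μ ≤ ((2 * c) ^ (q - p) * (C₂ * 2)
        + (2 * c) ^ (q - p / 2) * (C₂ * 2 + 1)) * (B * S ^ (q - p / 2)) := by
    have h2c : 0 < 2 * c * S := by positivity
    have hmax : ∀ (ω) (s : ℝ), 0 ≤ s → max (R ω) 0 ^ s ≤ |R ω| ^ s := fun ω s hs =>
      Real.rpow_le_rpow (le_max_right _ _) (max_le (le_abs_self _) (abs_nonneg _)) hs
    rcases le_total B (S ^ (p / 2)) with h | h
    · refine ⟨fun ω => |R ω| ^ p * (2 * c * S) ^ (q - p), hoff'.1.mul_const _, fun ω => ?_, ?_⟩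
      · refine (max_sub_rpow_le (s := p) hq (by linarith) h2c).trans ?_
        exact mul_le_mul_of_nonneg_right (hmax ω p (by linarith)) (by positivity)
      · rw [integral_mul_const, Real.mul_rpow (by positivity) hS.le]
        calc (∫ ω, |R ω| ^ p ∂μ) * ((2 * c) ^ (q - p) * S ^ (q - p))
            ≤ (C₂ * ((S ^ (p / 2) + S ^ (p / 2)) * B)) * ((2 * c) ^ (q - p) * S ^ (q - p)) := by
              gcongr
              refine hoff'.2.trans ?_
              gcongr
          _ = (2 * c) ^ (q - p) * (C₂ * 2) * (B * (S ^ (p / 2) * S ^ (q - p))) := by ring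
          _ = (2 * c) ^ (q - p) * (C₂ * 2) * (B * S ^ (q - p / 2)) := by
              rw [← Real.rpow_add hS]; congr 3; ring
          _ ≤ _ := by
              gcongr
              exact le_add_of_nonneg_right (by positivity)
    · refine ⟨fun ω => (|R ω| ^ p * B⁻¹ + B) * (2 * c * S) ^ (q - p / 2),
        ((hoff'.1.mul_const _).add (integrable_const _)).mul_const _, fun ω => ?_, ?_⟩
      · refine (max_sub_rpow_le (s := p / 2) hq hqp h2c).trans ?_
        refine mul_le_mul_of_nonneg_right ?_ (by positivity)
        refine (hmax ω (p / 2) (by linarith)).trans ?_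
        have h1 : |R ω| ^ p = (|R ω| ^ (p / 2)) ^ 2 := by
          rw [← Real.rpow_natCast, ← Real.rpow_mul (abs_nonneg _)]; congr 1; push_cast; ring
        rw [h1]
        set y := |R ω| ^ (p / 2)
        rw [← div_eq_mul_inv, div_add' _ _ _ hB0.ne', le_div_iff₀ hB0]
        nlinarith [sq_nonneg (y - B), sq_nonneg y, sq_nonneg B]
      · rw [integral_mul_const, integral_add (hoff'.1.mul_const _) (integrable_const _),
          integral_mul_const, Real.mul_rpow (by positivity) hS.le]
        simp only [integral_const, probReal_univ, smul_eq_mul, one_mul]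
        calc ((∫ ω, |R ω| ^ p ∂μ) * B⁻¹ + B) * ((2 * c) ^ (q - p / 2) * S ^ (q - p / 2))
            ≤ ((C₂ * ((B + B) * B)) * B⁻¹ + B) * ((2 * c) ^ (q - p / 2) * S ^ (q - p / 2)) := by
              gcongr
              refine hoff'.2.trans ?_
              gcongr
          _ = (2 * c) ^ (q - p / 2) * (C₂ * 2 + 1) * (B * S ^ (q - p / 2)) := by
              field_simp; ring
          _ ≤ _ := by
              gcongr
              exact le_add_of_nonneg_left (by positivity)
  obtain ⟨G, hGi, hGle, hGint⟩ := hRq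
  have hle : ∀ ω, max (‖∑ i, X i ω‖ ^ 2 - (1 + α) * S) 0 ^ q
      ≤ 2 ^ q * (max (T ω - (1 + c) * S) 0 ^ (p / 2) * (c * S) ^ (q - p / 2) + G ω) := by
    intro ω
    have h1 : max (‖∑ i, X i ω‖ ^ 2 - (1 + α) * S) 0
        ≤ max (T ω - (1 + c) * S - c * S) 0 + max (R ω - 2 * c * S) 0 := by
      have e1 : ‖∑ i, X i ω‖ ^ 2 - (1 + α) * S
          = (T ω - (1 + c) * S - c * S) + (R ω - 2 * c * S) := by
        simp only [hT, hR, hc]; ring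
      rw [e1]
      exact max_le (add_le_add (le_max_left _ _) (le_max_left _ _)) (by positivity)
    refine (Real.rpow_le_rpow (le_max_right _ _) h1 hq.le).trans
      ((add_rpow_le_two_mul hq.le (le_max_right _ _) (le_max_right _ _)).trans ?_)
    gcongr
    · exact max_sub_rpow_le hq hqp (by positivity)
    · exact hGle ω
  have hi2 : Integrable (fun ω => 2 ^ q *
      (max (T ω - (1 + c) * S) 0 ^ (p / 2) * (c * S) ^ (q - p / 2) + G ω)) μ :=
    ((hdiag'.1.mul_const _).add hGi).const_mul _
  have hi : Integrable (fun ω => max (‖∑ i, X i ω‖ ^ 2 - (1 + α) * S) 0 ^ q) μ :=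
    hi2.mono' ((((hmS.norm.pow_const 2).sub_const _).max measurable_const).pow_const q
      |>.aestronglyMeasurable) (ae_of_all _ fun ω => by
      rw [Real.norm_of_nonneg (by positivity)]; exact hle ω)
  refine ⟨hi, (integral_mono hi hi2 hle).trans ?_⟩
  rw [integral_const_mul, integral_add (hdiag'.1.mul_const _) hGi, integral_mul_const,
    Real.mul_rpow hc0.le hS.le]
  calc 2 ^ q * ((∫ ω, max (T ω - (1 + c) * S) 0 ^ (p / 2) ∂μ)
        * (c ^ (q - p / 2) * S ^ (q - p / 2)) + ∫ ω, G ω ∂μ)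
      ≤ 2 ^ q * ((C₁ * B) * (c ^ (q - p / 2) * S ^ (q - p / 2))
        + ((2 * c) ^ (q - p) * (C₂ * 2) + (2 * c) ^ (q - p / 2) * (C₂ * 2 + 1))
          * (B * S ^ (q - p / 2))) := by
        gcongr
        exact hdiag'.2.trans (by gcongr)
    _ = _ := by ring

/-! ### The oracle inequality on a fixed sample -/

theorem norm_sq_add_sub_starProjection {E : Type*} [NormedAddCommGroup E] [InnerProductSpace ℝ E]
    (L : Submodule ℝ E) [L.HasOrthogonalProjection] (f e : E) :
    ‖f + e - L.starProjection (f + e)‖ ^ 2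
      = ‖f - L.starProjection f‖ ^ 2 + 2 * inner ℝ e (f - L.starProjection f) + ‖e‖ ^ 2
        - ‖L.starProjection e‖ ^ 2 := by
  have h1 : inner ℝ (L.starProjection e) (f - L.starProjection f) = (0 : ℝ) :=
    L.sub_starProjection_mem_orthogonal f _ (L.starProjection_apply_mem e)
  have h2 : inner ℝ (L.starProjection e) (e - L.starProjection e) = (0 : ℝ) :=
    L.sub_starProjection_mem_orthogonal e _ (L.starProjection_apply_mem e)
  have h3 : f + e - L.starProjection (f + e)
      = (f - L.starProjection f) + (e - L.starProjection e) := by rw [map_add]; abel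
  set g := f - L.starProjection f
  set r := e - L.starProjection e with hr
  have h4 : e = L.starProjection e + r := by rw [hr]; abel
  have h5 : ‖e‖ ^ 2 = ‖r‖ ^ 2 + ‖L.starProjection e‖ ^ 2 := by
    conv_lhs => rw [h4]
    rw [norm_add_sq_real, h2]; ring
  have h6 : inner ℝ e g = (inner ℝ g r : ℝ) := by
    conv_lhs => rw [h4]
    rw [inner_add_left, h1, zero_add, real_inner_comm]
  rw [h3, norm_add_sq_real, h5, h6]
  ring

theorem norm_sq_sub_starProjection_add {E : Type*} [NormedAddCommGroup E] [InnerProductSpace ℝ E]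
    (L : Submodule ℝ E) [L.HasOrthogonalProjection] (f e : E) :
    ‖f - L.starProjection (f + e)‖ ^ 2
      = ‖f - L.starProjection f‖ ^ 2 + ‖L.starProjection e‖ ^ 2 := by
  have h1 : inner ℝ (f - L.starProjection f) (L.starProjection e) = (0 : ℝ) := by
    rw [real_inner_comm]
    exact L.sub_starProjection_mem_orthogonal f _ (L.starProjection_apply_mem e)
  rw [map_add, ← sub_sub, norm_sub_sq_real, h1]
  ring

/-- The unit vector in the direction of the bias `f - P f` of a model (zero if there is no bias). -/
noncomputable def biasDir {E : Type*} [NormedAddCommGroup E] [InnerProductSpace ℝ E]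
    (L : Submodule ℝ E) [L.HasOrthogonalProjection] (f : E) : E :=
  ‖f - L.starProjection f‖⁻¹ • (f - L.starProjection f)

theorem norm_biasDir_le {E : Type*} [NormedAddCommGroup E] [InnerProductSpace ℝ E]
    (L : Submodule ℝ E) [L.HasOrthogonalProjection] (f : E) : ‖biasDir L f‖ ≤ 1 := by
  rw [biasDir, norm_smul, norm_inv, norm_norm]
  exact inv_mul_le_one

/-- The excess noise of a model whose noise level is `S`: what exceeds fixed multiples of `S` in
the squared noise inside the model and in the squared noise along the bias. -/
noncomputable def excess {E : Type*} [NormedAddCommGroup E] [InnerProductSpace ℝ E] (θ S : ℝ)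
    (L : Submodule ℝ E) [L.HasOrthogonalProjection] (u e : E) : ℝ :=
  max (‖L.starProjection e‖ ^ 2 - (1 + θ / 4) * S) 0 + max (inner ℝ e u ^ 2 - θ / 8 * S) 0

theorem excess_nonneg {E : Type*} [NormedAddCommGroup E] [InnerProductSpace ℝ E] (θ S : ℝ)
    (L : Submodule ℝ E) [L.HasOrthogonalProjection] (u e : E) : 0 ≤ excess θ S L u e :=
  add_nonneg (le_max_right _ _) (le_max_right _ _)

/-- The loss of a model `L₁` whose penalized criterion is at most that of `L₂`. A fraction of the
penalty of `L₁` pays for its noise and for the cross term between noise and bias, up to the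
excess noise. -/
theorem norm_sq_sub_le_of_penalized_le {E : Type*} [NormedAddCommGroup E] [InnerProductSpace ℝ E]
    (L₁ L₂ : Submodule ℝ E) [L₁.HasOrthogonalProjection] [L₂.HasOrthogonalProjection] (f e : E)
    {θ S₁ S₂ : ℝ} (hθ : 0 < θ) (hS₁ : 0 ≤ S₁) (hS₂ : 0 ≤ S₂)
    (h : ‖f + e - L₁.starProjection (f + e)‖ ^ 2 + (1 + θ) * S₁
      ≤ ‖f + e - L₂.starProjection (f + e)‖ ^ 2 + (1 + θ) * S₂) :
    ‖f - L₁.starProjection (f + e)‖ ^ 2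
      ≤ (5 / 2 + 2 / θ) * (2 + 2 * θ) * (‖f - L₂.starProjection f‖ ^ 2 + S₂)
        + 2 * (5 / 2 + 2 / θ) *
          (excess θ S₁ L₁ (biasDir L₁ f) e + excess θ S₂ L₂ (biasDir L₂ f) e) := by
  rw [norm_sq_add_sub_starProjection, norm_sq_add_sub_starProjection] at h
  rw [norm_sq_sub_starProjection_add]
  have hin : ∀ (L : Submodule ℝ E) [L.HasOrthogonalProjection],
      inner ℝ e (f - L.starProjection f)
        = ‖f - L.starProjection f‖ * inner ℝ e (biasDir L f) := by
    intro L _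
    rw [biasDir, inner_smul_right]
    rcases eq_or_ne ‖f - L.starProjection f‖ 0 with h0 | h0
    · rw [norm_eq_zero.1 h0]; simp
    · field_simp
  rw [hin L₁, hin L₂] at h
  unfold excess
  set x₁ := (inner ℝ e (biasDir L₁ f) : ℝ)
  set x₂ := (inner ℝ e (biasDir L₂ f) : ℝ)
  set g₁ := ‖f - L₁.starProjection f‖
  set g₂ := ‖f - L₂.starProjection f‖
  set n₁ := ‖L₁.starProjection e‖ ^ 2
  have hn₂ : 0 ≤ ‖L₂.starProjection e‖ ^ 2 := sq_nonneg _
  have a1 := le_max_left (n₁ - (1 + θ / 4) * S₁) 0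
  have a2 := le_max_left (x₁ ^ 2 - θ / 8 * S₁) 0
  have a3 := le_max_left (x₂ ^ 2 - θ / 8 * S₂) 0
  have b1 := le_max_right (n₁ - (1 + θ / 4) * S₁) 0
  have b2 := le_max_right (x₁ ^ 2 - θ / 8 * S₁) 0
  have b3 := le_max_right (x₂ ^ 2 - θ / 8 * S₂) 0
  have b4 := le_max_right (‖L₂.starProjection e‖ ^ 2 - (1 + θ / 4) * S₂) 0
  set N₁ := max (n₁ - (1 + θ / 4) * S₁) 0
  set Q₁ := max (x₁ ^ 2 - θ / 8 * S₁) 0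
  set Q₂ := max (x₂ ^ 2 - θ / 8 * S₂) 0
  set N₂ := max (‖L₂.starProjection e‖ ^ 2 - (1 + θ / 4) * S₂) 0
  have c1 : -(2 * (g₁ * x₁)) ≤ g₁ ^ 2 / 2 + 2 * x₁ ^ 2 := by nlinarith [sq_nonneg (g₁ + 2 * x₁)]
  have c2 : 2 * (g₂ * x₂) ≤ g₂ ^ 2 / 2 + 2 * x₂ ^ 2 := by nlinarith [sq_nonneg (g₂ - 2 * x₂)]
  set T := 3 / 2 * g₂ ^ 2 + (1 + 5 / 4 * θ) * S₂ with hT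
  have main : g₁ ^ 2 / 2 + θ / 2 * S₁ ≤ T + N₁ + 2 * Q₁ + 2 * Q₂ := by
    rw [hT]; linarith
  have hK : 0 < 5 / 2 + 2 / θ := by positivity
  have e1 : (5 / 2 + 2 / θ) * (g₁ ^ 2 / 2 + θ / 2 * S₁)
      = (5 / 4 + 1 / θ) * g₁ ^ 2 + (1 + 5 / 4 * θ) * S₁ := by field_simp; ring
  have e2 := mul_le_mul_of_nonneg_left main hK.le
  have e3 : 0 ≤ 1 / θ * g₁ ^ 2 := by positivity
  have e4 : 0 ≤ 1 / θ := by positivity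
  have e5 : 1 ≤ 5 / 2 + 2 / θ := by
    have : 0 ≤ 2 / θ := by positivity
    linarith
  have e6 : T ≤ (2 + 2 * θ) * (g₂ ^ 2 + S₂) := by
    rw [hT]
    nlinarith [sq_nonneg g₂, mul_nonneg hθ.le hS₂, mul_nonneg hθ.le (sq_nonneg g₂)]
  have e7 := mul_le_mul_of_nonneg_left e6 hK.le
  have e8 : N₁ ≤ (5 / 2 + 2 / θ) * N₁ := le_mul_of_one_le_left b1 e5
  have e9 : 0 ≤ (5 / 2 + 2 / θ) * N₂ := mul_nonneg hK.le b4
  have e10 : 0 ≤ θ * S₁ := by positivity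
  nlinarith [sq_nonneg g₁]

/-! ### From pointwise bounds to moments -/

theorem exists_rpow_add_rpow_rpow_inv_le {q : ℝ} (hq : 0 < q) :
    ∃ C : ℝ, 0 < C ∧ ∀ x y : ℝ, 0 ≤ x → 0 ≤ y →
      (x ^ q + y ^ q) ^ (1 / q) ≤ 4 / 3 * x + C * y := by
  have hk : 0 < (4 / 3 : ℝ) ^ q - 1 := by
    have := Real.one_lt_rpow (x := 4 / 3) (by norm_num) hq
    linarith
  set k := (4 / 3 : ℝ) ^ q - 1 with hkdef
  have hroot : ∀ c z : ℝ, 0 ≤ c → 0 ≤ z → (c * z ^ q) ^ (1 / q) = c ^ (1 / q) * z := by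
    intro c z hc hz
    rw [Real.mul_rpow hc (by positivity), ← Real.rpow_mul hz, mul_one_div_cancel hq.ne',
      Real.rpow_one]
  refine ⟨(k⁻¹ + 1) ^ (1 / q), by positivity, fun x y hx hy => ?_⟩
  have hq' : 0 ≤ 1 / q := by positivity
  rcases le_total (y ^ q) (k * x ^ q) with h | h
  · have h1 : (x ^ q + y ^ q) ^ (1 / q) ≤ ((4 / 3 : ℝ) ^ q * x ^ q) ^ (1 / q) := by
      refine Real.rpow_le_rpow (by positivity) ?_ hq'
      rw [hkdef] at h; linarith
    rw [hroot _ _ (by positivity) hx, ← Real.rpow_mul (by norm_num), mul_one_div_cancel hq.ne',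
      Real.rpow_one] at h1
    have : 0 ≤ (k⁻¹ + 1) ^ (1 / q) * y := by positivity
    linarith
  · have h1 : (x ^ q + y ^ q) ^ (1 / q) ≤ ((k⁻¹ + 1) * y ^ q) ^ (1 / q) := by
      refine Real.rpow_le_rpow (by positivity) ?_ hq'
      have : x ^ q ≤ k⁻¹ * y ^ q := by
        rw [← div_eq_inv_mul, le_div_iff₀ hk]; linarith
      linarith
    rw [hroot _ _ (by positivity) hy] at h1
    linarith

/-- A quasi-norm bound for `a + b` with `a` deterministic in which the constant of `a` does not
depend on the order `q > 0`. -/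
theorem exists_integral_rpow_rpow_inv_le.{u} {q : ℝ} (hq : 0 < q) :
    ∃ C : ℝ, 0 < C ∧ ∀ {Ω : Type u} [MeasurableSpace Ω] (μ : Measure Ω) [IsProbabilityMeasure μ]
      (l b : Ω → ℝ) (a y : ℝ), 0 ≤ a → 0 ≤ y → AEStronglyMeasurable (fun ω => l ω ^ q) μ →
      (∀ ω, 0 ≤ l ω) → (∀ ω, 0 ≤ b ω) → (∀ ω, l ω ≤ a + b ω) →
      Integrable (fun ω => b ω ^ q) μ → ∫ ω, b ω ^ q ∂μ ≤ y ^ q →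
      Integrable (fun ω => l ω ^ q) μ ∧ (∫ ω, l ω ^ q ∂μ) ^ (1 / q) ≤ 2 * a + C * y := by
  obtain ⟨C, hC, hCle⟩ := exists_rpow_add_rpow_rpow_inv_le hq
  refine ⟨C * 3, by positivity, ?_⟩
  intro Ω _ μ _ l b a y ha hy hm hl hb hlab hbi hby
  have hle : ∀ ω, l ω ^ q ≤ (3 / 2 * a) ^ q + 3 ^ q * b ω ^ q := by
    intro ω
    refine (Real.rpow_le_rpow (hl ω) (hlab ω) hq.le).trans ?_
    have hbω := hb ω
    have h1 : 0 ≤ (3 / 2 * a) ^ q := by positivity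
    have h2 : 0 ≤ 3 ^ q * b ω ^ q := by positivity
    rcases le_total (b ω) (a / 2) with h | h
    · have := Real.rpow_le_rpow (by positivity) (by linarith : a + b ω ≤ 3 / 2 * a) hq.le
      linarith
    · have := Real.rpow_le_rpow (by positivity) (by linarith : a + b ω ≤ 3 * b ω) hq.le
      rw [Real.mul_rpow (by norm_num) hbω] at this
      linarith
  have hi2 : Integrable (fun ω => (3 / 2 * a) ^ q + 3 ^ q * b ω ^ q) μ :=
    (integrable_const _).add (hbi.const_mul _)
  have hi : Integrable (fun ω => l ω ^ q) μ := hi2.mono' hm (ae_of_all _ fun ω => by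
    rw [Real.norm_of_nonneg (Real.rpow_nonneg (hl ω) q)]; exact hle ω)
  refine ⟨hi, ?_⟩
  have h1 : ∫ ω, l ω ^ q ∂μ ≤ (3 / 2 * a) ^ q + (3 * y) ^ q := by
    refine (integral_mono hi hi2 hle).trans ?_
    rw [integral_add (integrable_const _) (hbi.const_mul _), integral_const_mul,
      Real.mul_rpow (by norm_num : (0 : ℝ) ≤ 3) hy]
    simp only [integral_const, probReal_univ, smul_eq_mul, one_mul]
    gcongr
  have h2 : (∫ ω, l ω ^ q ∂μ) ^ (1 / q) ≤ ((3 / 2 * a) ^ q + (3 * y) ^ q) ^ (1 / q) :=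
    Real.rpow_le_rpow (integral_nonneg fun ω => Real.rpow_nonneg (hl ω) q) h1 (by positivity)
  refine h2.trans ((hCle _ _ (by positivity) (by positivity)).trans (le_of_eq ?_))
  ring

/-! ### Blocks of `ℝ^{Nd}` -/

theorem normN_sq {N d : ℕ} (a : Vec N d) : normN a ^ 2 = ‖a‖ ^ 2 / N := by
  have h : innerN a a = ‖a‖ ^ 2 / N := by
    rw [innerN, EuclideanSpace.norm_sq_eq, Fintype.sum_prod_type, one_div, ← div_eq_inv_mul]
    simp only [Real.norm_eq_abs, sq_abs]
    simp only [sq]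
  rw [normN, Real.sq_sqrt (by rw [h]; positivity), h]

/-- The embedding of `ℝ^d` as the `i`-th block of `ℝ^{Nd}`. -/
noncomputable def blockEmb {N d : ℕ} (i : Fin N) : EuclideanSpace ℝ (Fin d) →L[ℝ] Vec N d :=
  ∑ j, (EuclideanSpace.proj j).smulRight (EuclideanSpace.single (i, j) (1 : ℝ))

theorem blockEmb_apply {N d : ℕ} (i : Fin N) (v : EuclideanSpace ℝ (Fin d)) :
    blockEmb i v = ∑ j, v j • EuclideanSpace.single (i, j) (1 : ℝ) := by
  simp [blockEmb]

theorem inner_blockEmb {N d : ℕ} (i : Fin N) (v : EuclideanSpace ℝ (Fin d)) (x : Vec N d) :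
    inner ℝ x (blockEmb i v) = ∑ j, v j * x (i, j) := by
  simp [blockEmb_apply, inner_sum, inner_smul_right, EuclideanSpace.inner_single_right]

theorem stack_eq_sum_blockEmb {N d : ℕ} (v : Fin N → EuclideanSpace ℝ (Fin d)) :
    stack v = ∑ i, blockEmb i (v i) := by
  refine ext_inner_left ℝ fun x => ?_
  simp only [inner_sum, inner_blockEmb]
  rw [PiLp.inner_apply, Fintype.sum_prod_type]
  simp [stack]

theorem blockEmb_apply_apply {N d : ℕ} (i i' : Fin N) (j : Fin d)
    (v : EuclideanSpace ℝ (Fin d)) : blockEmb i v (i', j) = if i' = i then v j else 0 := by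
  rw [blockEmb_apply]
  by_cases h : i' = i
  · subst h; simp [Finset.sum_apply, Pi.single_apply]
  · simp [Finset.sum_apply, h]

theorem norm_blockEmb {N d : ℕ} (i : Fin N) (v : EuclideanSpace ℝ (Fin d)) :
    ‖(blockEmb i v : Vec N d)‖ = ‖v‖ := by
  have h : ‖(blockEmb i v : Vec N d)‖ ^ 2 = ‖v‖ ^ 2 := by
    rw [← real_inner_self_eq_norm_sq, inner_blockEmb, EuclideanSpace.norm_sq_eq]
    exact Finset.sum_congr rfl fun j _ => by
      rw [blockEmb_apply_apply, if_pos rfl, Real.norm_eq_abs, sq_abs, sq]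
  exact (sq_eq_sq₀ (norm_nonneg _) (norm_nonneg _)).1 h

theorem inner_blockEmb_sq_le {N d : ℕ} (i : Fin N) (v : EuclideanSpace ℝ (Fin d)) (x : Vec N d) :
    inner ℝ x (blockEmb i v) ^ 2 ≤ (∑ j, x (i, j) ^ 2) * ‖v‖ ^ 2 := by
  rw [inner_blockEmb, EuclideanSpace.norm_sq_eq, mul_comm]
  simpa using Finset.sum_mul_sq_le_sq_mul_sq Finset.univ (fun j => v j) fun j => x (i, j)

theorem sum_sum_sq_eq_norm_sq {N d : ℕ} (x : Vec N d) : ∑ i, ∑ j, x (i, j) ^ 2 = ‖x‖ ^ 2 := by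
  rw [EuclideanSpace.norm_sq_eq, Fintype.sum_prod_type]
  simp

theorem norm_starProjection_le {N d : ℕ} (L : Submodule ℝ (Vec N d)) (x : Vec N d) :
    ‖L.starProjection x‖ ≤ ‖x‖ := by
  have := L.starProjection.le_of_opNorm_le L.starProjection_norm_le x
  simpa using this

theorem norm_sq_starProjection_blockEmb_le {N d : ℕ} (L : Submodule ℝ (Vec N d)) (i : Fin N)
    (v : EuclideanSpace ℝ (Fin d)) :
    ‖L.starProjection (blockEmb i v)‖ ^ 2
      ≤ (∑ j, ‖L.starProjection (EuclideanSpace.single (i, j) (1 : ℝ))‖ ^ 2) * ‖v‖ ^ 2 := by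
  rw [blockEmb_apply, map_sum]
  simp only [map_smul]
  have h1 : ‖∑ j, v j • L.starProjection (EuclideanSpace.single (i, j) (1 : ℝ))‖
      ≤ ∑ j, |v j| * ‖L.starProjection (EuclideanSpace.single (i, j) (1 : ℝ))‖ :=
    (norm_sum_le _ _).trans (le_of_eq (Finset.sum_congr rfl fun j _ => by
      rw [norm_smul, Real.norm_eq_abs]))
  refine (pow_le_pow_left₀ (norm_nonneg _) h1 2).trans ?_
  refine (Finset.sum_mul_sq_le_sq_mul_sq _ _ _).trans (le_of_eq ?_)
  rw [EuclideanSpace.norm_sq_eq, mul_comm]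
  simp

/-- The trace of an orthogonal projection is its rank. -/
theorem sum_norm_sq_starProjection_single {N d : ℕ} (L : Submodule ℝ (Vec N d)) :
    ∑ i, ∑ j, ‖L.starProjection (EuclideanSpace.single (i, j) (1 : ℝ))‖ ^ 2 = dimM L := by
  have hproj : LinearMap.IsProj L (L.starProjection : Vec N d →ₗ[ℝ] Vec N d) :=
    ⟨fun x => L.starProjection_apply_mem x,
      fun x hx => Submodule.starProjection_eq_self_iff.2 hx⟩
  have h := hproj.trace
  rw [LinearMap.trace_eq_sum_inner _ (EuclideanSpace.basisFun (Fin N × Fin d) ℝ),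
    Fintype.sum_prod_type] at h
  rw [dimM, ← h]
  refine Finset.sum_congr rfl fun i _ => Finset.sum_congr rfl fun j _ => ?_
  rw [EuclideanSpace.basisFun_apply, ContinuousLinearMap.coe_coe,
    ← Submodule.starProjection_eq_self_iff.2 (L.starProjection_apply_mem _),
    ← Submodule.inner_starProjection_left_eq_right,
    Submodule.starProjection_eq_self_iff.2 (L.starProjection_apply_mem _),
    real_inner_self_eq_norm_sq]

theorem norm_sq_starProjection_blockEmb {N d : ℕ} (L : Submodule ℝ (Vec N d)) (i : Fin N)
    (v : EuclideanSpace ℝ (Fin d)) :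
    ‖L.starProjection (blockEmb i v)‖ ^ 2
      = ∑ j, ∑ k, projMatrix L (i, j) (i, k) * (v k * v j) := by
  have h : inner ℝ (L.starProjection (blockEmb i v)) (blockEmb i v)
      = ‖L.starProjection (blockEmb i v)‖ ^ 2 := by
    rw [← real_inner_self_eq_norm_sq, ← Submodule.inner_starProjection_left_eq_right,
      Submodule.starProjection_eq_self_iff.2 (L.starProjection_apply_mem _)]
  rw [← h, inner_blockEmb]
  refine Finset.sum_congr rfl fun j _ => ?_
  conv_lhs => rw [blockEmb_apply, map_sum]
  simp only [map_smul, projMatrix, proj, Matrix.of_apply]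
  rw [WithLp.ofLp_sum, Finset.sum_apply, Finset.mul_sum]
  refine Finset.sum_congr rfl fun k _ => ?_
  simp only [PiLp.smul_apply, smul_eq_mul]
  ring

theorem trace_projMatrix_mul_kronecker {N d : ℕ} (Φ : Matrix (Fin d) (Fin d) ℝ)
    (L : Submodule ℝ (Vec N d)) :
    (projMatrix L * ((1 : Matrix (Fin N) (Fin N) ℝ) ⊗ₖ Φ)).trace
      = ∑ i, ∑ j, ∑ k, projMatrix L (i, j) (i, k) * Φ k j := by
  simp only [Matrix.trace, Matrix.diag, Matrix.mul_apply, Fintype.sum_prod_type,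
    Matrix.kroneckerMap_apply, Matrix.one_apply]
  refine Finset.sum_congr rfl fun i _ => Finset.sum_congr rfl fun j _ => ?_
  rw [Finset.sum_eq_single i (fun b _ hb => by simp [hb]) (by simp)]
  simp

theorem rpow_le_mul_rpow_of_sq_le {p t x y : ℝ} (hp : 2 ≤ p) (hx : 0 ≤ x)
    (hxy : x ≤ y) (h : x ^ 2 ≤ t * y ^ 2) : x ^ p ≤ t * y ^ p := by
  have hy : 0 ≤ y := hx.trans hxy
  have hs : ∀ z : ℝ, 0 ≤ z → z ^ p = z ^ 2 * z ^ (p - 2) := fun z hz => by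
    rcases hz.eq_or_lt with rfl | hz
    · rw [Real.zero_rpow (by linarith)]; simp
    · rw [← Real.rpow_natCast, ← Real.rpow_add hz]; congr 1; push_cast; ring
  rw [hs x hx, hs y hy]
  calc x ^ 2 * x ^ (p - 2) ≤ (t * y ^ 2) * y ^ (p - 2) :=
        mul_le_mul h (Real.rpow_le_rpow hx hxy (by linarith)) (by positivity)
          ((sq_nonneg x).trans h)
    _ = _ := by ring

/-! ### Moments of the noise -/

/-- Jensen's inequality for the second moment, in terms of a scale `x`. -/
theorem integral_norm_sq_le_of_integral_norm_rpow_le {Ω E : Type*} [MeasurableSpace Ω]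
    [NormedAddCommGroup E] {μ : Measure Ω} [IsProbabilityMeasure μ] {X : Ω → E}
    (hX : AEStronglyMeasurable X μ) {p x : ℝ} (hp : 2 ≤ p)
    (hi : Integrable (fun ω => ‖X ω‖ ^ p) μ) (hx : 0 < x) (h : ∫ ω, ‖X ω‖ ^ p ∂μ ≤ x ^ p) :
    ∫ ω, ‖X ω‖ ^ 2 ∂μ ≤ x ^ 2 := by
  have hsq : ∀ y : ℝ, 0 ≤ y → (y ^ 2) ^ (p / 2) = y ^ p := fun y hy => by
    rw [← Real.rpow_natCast, ← Real.rpow_mul hy]; congr 1; push_cast; ring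
  have hi2 : Integrable (fun ω => ‖X ω‖ ^ 2) μ := by
    simpa using integrable_norm_rpow_of_le hX zero_le_two hp hi
  set c := p / 2 * (x ^ 2) ^ (p / 2 - 1) with hc
  have hc0 : 0 < c := by positivity
  have hle : ∀ ω, x ^ p + c * (‖X ω‖ ^ 2 - x ^ 2) ≤ ‖X ω‖ ^ p := fun ω => by
    have := rpow_tangent_le (s := p / 2) (x := x ^ 2) (y := ‖X ω‖ ^ 2) (by linarith)
      (sq_nonneg x) (sq_nonneg _)
    rwa [hsq x hx.le, hsq _ (norm_nonneg _)] at this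
  have hi3 : Integrable (fun ω => c * (‖X ω‖ ^ 2 - x ^ 2)) μ :=
    (hi2.sub (integrable_const (x ^ 2))).const_mul c
  have h1 := integral_mono ((integrable_const (x ^ p)).add hi3) hi hle
  simp only [Pi.add_apply] at h1
  rw [integral_add (integrable_const _) hi3,
    integral_const_mul, integral_sub hi2 (integrable_const _)] at h1
  simp only [integral_const, probReal_univ, smul_eq_mul, one_mul] at h1
  have h2 : c * (∫ ω, ‖X ω‖ ^ 2 ∂μ - x ^ 2) ≤ 0 := by linarith
  by_contra! h3
  have := mul_pos hc0 (sub_pos.2 h3)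
  linarith

theorem covMatrix_apply_of_centered {d : ℕ} {Ω : Type*} [MeasurableSpace Ω] {μ : Measure Ω}
    {X : Ω → EuclideanSpace ℝ (Fin d)} (hi : Integrable X μ) (h : ∫ ω, X ω ∂μ = 0)
    (j k : Fin d) : covMatrix μ X j k = ∫ ω, X ω j * X ω k ∂μ := by
  have hc : ∀ j, ∫ ω, X ω j ∂μ = 0 := fun j => by
    have := (EuclideanSpace.proj j : EuclideanSpace ℝ (Fin d) →L[ℝ] ℝ).integral_comp_comm hi
    rw [h, map_zero] at this
    exact this
  simp [covMatrix, covariance, hc]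

theorem measurable_excess {N d : ℕ} {Ω : Type*} [MeasurableSpace Ω] {e : Ω → Vec N d}
    (he : Measurable e) (θ S : ℝ) (L : Submodule ℝ (Vec N d)) (y : Vec N d) :
    Measurable fun ω => excess θ S L y (e ω) := by
  have h1 : Measurable fun ω => L.starProjection (e ω) :=
    L.starProjection.continuous.measurable.comp he
  have h2 : Measurable fun ω => (inner ℝ (e ω) y : ℝ) := he.inner measurable_const
  exact (((h1.norm.pow_const 2).sub_const _).max measurable_const).add
    (((h2.pow_const 2).sub_const _).max measurable_const)

theorem measurable_stack {N d : ℕ} {Ω : Type*} [MeasurableSpace Ω]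
    {ε : Fin N → Ω → EuclideanSpace ℝ (Fin d)} (hε : ∀ i, Measurable (ε i)) :
    Measurable fun ω => stack fun i => ε i ω := by
  simp only [stack_eq_sum_blockEmb]
  exact Finset.measurable_sum _ fun i _ => (blockEmb i).continuous.measurable.comp (hε i)

theorem measurable_apply_of_countable {ι Ω E : Type*} [Countable ι] [MeasurableSpace Ω]
    [MeasurableSpace E] {g : ι → Ω → E} (hg : ∀ i, Measurable (g i)) {m : Ω → ι}
    (hm : ∀ i, MeasurableSet (m ⁻¹' {i})) : Measurable fun ω => g (m ω) ω := by
  intro s hs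
  have h : (fun ω => g (m ω) ω) ⁻¹' s = ⋃ i, m ⁻¹' {i} ∩ g i ⁻¹' s := by
    ext ω; simp
  rw [h]
  exact MeasurableSet.iUnion fun i => (hm i).inter (hg i hs)

/-- `δ ^ 2 D` is the second moment of the projected noise. -/
theorem sum_integral_norm_sq_starProjection_blockEmb {N d : ℕ} {Ω : Type*} [MeasurableSpace Ω]
    {μ : Measure Ω} [IsProbabilityMeasure μ] {X : Ω → EuclideanSpace ℝ (Fin d)}
    {ε : Fin N → Ω → EuclideanSpace ℝ (Fin d)} (hid : ∀ i, IdentDistrib (ε i) X μ μ)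
    (hX : Measurable X) (hi2 : Integrable (fun ω => ‖X ω‖ ^ 2) μ) (hi1 : Integrable X μ)
    (hcen : ∫ ω, X ω ∂μ = 0) {L : Submodule ℝ (Vec N d)} (hL : dimM L ≠ 0) :
    ∑ i, ∫ ω, ‖L.starProjection (blockEmb i (ε i ω))‖ ^ 2 ∂μ
      = deltaSq (covMatrix μ X) L * dimM L := by
  rw [deltaSq, div_mul_cancel₀ _ (Nat.cast_ne_zero.2 hL), trace_projMatrix_mul_kronecker]
  refine Finset.sum_congr rfl fun i _ => ?_
  have hm : Measurable fun v : EuclideanSpace ℝ (Fin d) =>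
      ‖L.starProjection (blockEmb i v)‖ ^ 2 := by
    have : Continuous fun v : EuclideanSpace ℝ (Fin d) =>
      ‖L.starProjection (blockEmb i v)‖ ^ 2 := by fun_prop
    exact this.measurable
  have h1 := ((hid i).comp hm).integral_eq
  simp only [Function.comp_def] at h1
  have hjk : ∀ j k, Integrable (fun ω => X ω k * X ω j) μ := fun j k => by
    have hmk : ∀ k, Measurable fun ω => X ω k := fun k =>
      (EuclideanSpace.proj k : EuclideanSpace ℝ (Fin d) →L[ℝ] ℝ).continuous.measurable.comp hX
    refine hi2.mono' ((hmk k).mul (hmk j)).aestronglyMeasurable (ae_of_all _ fun ω => ?_)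
    rw [norm_mul, sq]
    exact mul_le_mul (PiLp.norm_apply_le _ k) (PiLp.norm_apply_le _ j) (norm_nonneg _)
      (norm_nonneg _)
  rw [h1]
  simp only [norm_sq_starProjection_blockEmb]
  rw [integral_finsetSum _ fun j _ => integrable_finsetSum _ fun k _ => (hjk j k).const_mul _]
  refine Finset.sum_congr rfl fun j _ => ?_
  rw [integral_finsetSum _ fun k _ => (hjk j k).const_mul _]
  refine Finset.sum_congr rfl fun k _ => ?_
  rw [integral_const_mul, covMatrix_apply_of_centered hi1 hcen]

/-- Moment bound for the excess noise of one model. The weak variance of the noise is at most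
`𝔼 ‖X‖ ^ 2 ≤ (𝔼 ‖X‖ ^ p) ^ (2 / p)`, and the projections of the blocks have moments of order `p`
that sum up to at most `D 𝔼 ‖X‖ ^ p`. -/
theorem exists_integral_excess_rpow_le.{u} {θ p q : ℝ} (hθ : 0 < θ) (hp : 2 ≤ p) (hq : 0 < q)
    (hqp : q ≤ p / 2) :
    ∃ C : ℝ, 0 < C ∧ ∀ (N d : ℕ) {Ω : Type u} [MeasurableSpace Ω] (μ : Measure Ω)
      [IsProbabilityMeasure μ] (ε : Fin N → Ω → EuclideanSpace ℝ (Fin d))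
      (X : Ω → EuclideanSpace ℝ (Fin d)) (L : Submodule ℝ (Vec N d)) (y : Vec N d) (S : ℝ),
      (∀ i, Measurable (ε i)) → Measurable X → iIndepFun ε μ →
      (∀ i, IdentDistrib (ε i) X μ μ) → Integrable (fun ω => ‖X ω‖ ^ p) μ →
      ∫ ω, X ω ∂μ = 0 → 1 ≤ dimM L → S = deltaSq (covMatrix μ X) L * dimM L → 0 < S →
      ‖y‖ ≤ 1 →
      Integrable (fun ω => excess θ S L y (stack fun i => ε i ω) ^ q) μ ∧
      ∫ ω, excess θ S L y (stack fun i => ε i ω) ^ q ∂μ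
        ≤ C * ((∫ ω, ‖X ω‖ ^ p ∂μ) * (dimM L * S ^ (q - p / 2))) := by
  obtain ⟨C₁, hC₁, hquad⟩ := exists_integral_max_norm_sq_sum_sub_rpow_le.{u, 0, 0}
    (α := θ / 4) (by positivity) hp hq hqp
  obtain ⟨C₂, hC₂, hros⟩ := exists_integral_norm_sum_rpow_le.{u, 0, 0} hp
  refine ⟨2 ^ q * (C₁ + C₂ * 2 * (θ / 8) ^ (q - p / 2)), by positivity, ?_⟩
  intro N d Ω _ μ _ ε X L y S hε hX hind hid hint hcen hD hSdef hS hy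
  set M := ∫ ω, ‖X ω‖ ^ p ∂μ with hM
  have hM0 : 0 ≤ M := integral_nonneg fun ω => by positivity
  have hi2 : Integrable (fun ω => ‖X ω‖ ^ 2) μ := by
    simpa using integrable_norm_rpow_of_le hX.aestronglyMeasurable zero_le_two hp hint
  have hi1 : Integrable X μ := by
    have := integrable_norm_rpow_of_le (μ := μ) hX.aestronglyMeasurable (r := 1) (p := p)
      zero_le_one (by linarith) hint
    simp only [Real.rpow_one] at this
    exact (integrable_norm_iff hX.aestronglyMeasurable).1 this
  have hSsum : ∑ i, ∫ ω, ‖L.starProjection (blockEmb i (ε i ω))‖ ^ 2 ∂μ = S := by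
    rw [hSdef]
    exact sum_integral_norm_sq_starProjection_blockEmb hid hX hi2 hi1 hcen (by omega)
  have hmp : Measurable fun v : EuclideanSpace ℝ (Fin d) => ‖v‖ ^ p := measurable_norm.pow_const p
  have hm2 : Measurable fun v : EuclideanSpace ℝ (Fin d) => ‖v‖ ^ 2 := measurable_norm.pow_const 2
  have hεp : ∀ i, Integrable (fun ω => ‖ε i ω‖ ^ p) μ := fun i =>
    ((hid i).comp hmp).integrable_iff.2 hint
  have hε2 : ∀ i, Integrable (fun ω => ‖ε i ω‖ ^ 2) μ := fun i =>
    ((hid i).comp hm2).integrable_iff.2 hi2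
  have hε1 : ∀ i, Integrable (ε i) μ := fun i => (hid i).integrable_iff.2 hi1
  have hεM : ∀ i, ∫ ω, ‖ε i ω‖ ^ p ∂μ = M := fun i => ((hid i).comp hmp).integral_eq
  have hεV : ∀ i, ∫ ω, ‖ε i ω‖ ^ 2 ∂μ = ∫ ω, ‖X ω‖ ^ 2 ∂μ := fun i =>
    ((hid i).comp hm2).integral_eq
  have hεc : ∀ i, ∫ ω, ε i ω ∂μ = 0 := fun i => (hid i).integral_eq.trans hcen
  have hPle : ∀ i (v : EuclideanSpace ℝ (Fin d)), ‖L.starProjection (blockEmb i v)‖ ≤ ‖v‖ :=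
    fun i v => (norm_starProjection_le L _).trans (norm_blockEmb i v).le
  -- a degenerate noise would make `S` vanish
  have hMpos : 0 < M := by
    by_contra! hM'
    have hM1 : M = 0 := le_antisymm hM' hM0
    have hbd : ∀ x : ℝ, 0 < x → S ≤ N * x ^ 2 := by
      intro x hx
      have h1 : ∫ ω, ‖X ω‖ ^ 2 ∂μ ≤ x ^ 2 :=
        integral_norm_sq_le_of_integral_norm_rpow_le hX.aestronglyMeasurable hp hint hx
          (by rw [← hM, hM1]; positivity)
      rw [← hSsum]
      calc ∑ i, ∫ ω, ‖L.starProjection (blockEmb i (ε i ω))‖ ^ 2 ∂μ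
          ≤ ∑ _i : Fin N, x ^ 2 := Finset.sum_le_sum fun i _ => by
            refine (integral_mono_of_nonneg (ae_of_all _ fun ω => sq_nonneg _) (hε2 i)
              (ae_of_all _ fun ω => ?_)).trans ((hεV i).le.trans h1)
            exact pow_le_pow_left₀ (norm_nonneg _) (hPle i _) 2
        _ = N * x ^ 2 := by simp
    have h2 := hbd (Real.sqrt (S / (2 * (N + 1)))) (Real.sqrt_pos.2 (by positivity))
    rw [Real.sq_sqrt (by positivity)] at h2
    have h3 : (N : ℝ) * (S / (2 * (N + 1))) ≤ S / 2 := by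
      rw [mul_div_assoc', div_le_div_iff₀ (by positivity) (by positivity)]
      nlinarith
    linarith
  set τ := M ^ (1 / p) with hτdef
  have hτ : 0 < τ := by positivity
  have hτp : τ ^ p = M := by
    rw [hτdef, ← Real.rpow_mul hM0, one_div_mul_cancel (by linarith), Real.rpow_one]
  have hVτ : ∫ ω, ‖X ω‖ ^ 2 ∂μ ≤ τ ^ 2 :=
    integral_norm_sq_le_of_integral_norm_rpow_le hX.aestronglyMeasurable hp hint hτ hτp.ge
  have hD1 : (1 : ℝ) ≤ dimM L := by exact_mod_cast hD
  -- the weak variance of the noise is at most `τ ^ 2`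
  have hweak : ∀ z : Vec N d,
      ∑ i, ∫ ω, inner ℝ z (blockEmb i (ε i ω)) ^ 2 ∂μ ≤ τ ^ 2 * ‖z‖ ^ 2 := by
    intro z
    calc ∑ i, ∫ ω, inner ℝ z (blockEmb i (ε i ω)) ^ 2 ∂μ
        ≤ ∑ i, (∑ j, z (i, j) ^ 2) * τ ^ 2 := Finset.sum_le_sum fun i _ => by
          refine (integral_mono_of_nonneg (ae_of_all _ fun ω => sq_nonneg _)
            ((hε2 i).const_mul _)
            (ae_of_all _ fun ω => inner_blockEmb_sq_le i (ε i ω) z)).trans ?_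
          rw [integral_const_mul, hεV i]
          exact mul_le_mul_of_nonneg_left hVτ (Finset.sum_nonneg fun j _ => sq_nonneg _)
      _ = τ ^ 2 * ‖z‖ ^ 2 := by rw [← Finset.sum_mul, sum_sum_sq_eq_norm_sq, mul_comm]
  have hmP : ∀ i, Measurable fun v : EuclideanSpace ℝ (Fin d) =>
      L.starProjection (blockEmb i v) := fun i =>
    (L.starProjection.continuous.comp (blockEmb i).continuous).measurable
  have hmI : ∀ i, Measurable fun v : EuclideanSpace ℝ (Fin d) =>
      (inner ℝ y (blockEmb i v) : ℝ) := fun i =>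
    measurable_const.inner (blockEmb i).continuous.measurable
  -- the squared norm of the projected noise
  have hP : Integrable (fun ω => max (‖L.starProjection (stack fun i => ε i ω)‖ ^ 2
        - (1 + θ / 4) * S) 0 ^ q) μ ∧
      ∫ ω, max (‖L.starProjection (stack fun i => ε i ω)‖ ^ 2 - (1 + θ / 4) * S) 0 ^ q ∂μ
        ≤ C₁ * (dimM L * M * S ^ (q - p / 2)) := by
    have hbd : ∀ i ω, ‖L.starProjection (blockEmb i (ε i ω))‖ ^ p
        ≤ (∑ j, ‖L.starProjection (EuclideanSpace.single (i, j) (1 : ℝ))‖ ^ 2) * ‖ε i ω‖ ^ p :=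
      fun i ω => rpow_le_mul_rpow_of_sq_le hp (norm_nonneg _) (hPle i _)
        (norm_sq_starProjection_blockEmb_le L i _)
    have := hquad μ (fun i ω => L.starProjection (blockEmb i (ε i ω))) S τ (dimM L * M)
      (fun i => (hmP i).comp (hε i)) (hind.comp _ hmP)
      (fun i => by
        have h := (L.starProjection.comp (blockEmb i)).integral_comp_comm (hε1 i)
        rw [hεc i, map_zero] at h
        exact h)
      (fun i => ((hεp i).const_mul _).mono'
        (((hmP i).comp (hε i)).norm.pow_const p).aestronglyMeasurable
        (ae_of_all _ fun ω => by
          rw [Real.norm_of_nonneg (by positivity)]; exact hbd i ω))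
      hS hSsum hτ (fun z => by
        simp only [← Submodule.inner_starProjection_left_eq_right]
        refine (hweak _).trans ?_
        have := norm_starProjection_le L z
        gcongr)
      (by rw [hτp]; exact le_mul_of_one_le_left hM0 hD1)
      (by
        calc ∑ i, ∫ ω, ‖L.starProjection (blockEmb i (ε i ω))‖ ^ p ∂μ
            ≤ ∑ i, (∑ j, ‖L.starProjection (EuclideanSpace.single (i, j) (1 : ℝ))‖ ^ 2) * M :=
              Finset.sum_le_sum fun i _ => by
                refine (integral_mono_of_nonneg (ae_of_all _ fun ω => by positivity)
                  ((hεp i).const_mul _) (ae_of_all _ fun ω => hbd i ω)).trans ?_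
                rw [integral_const_mul, hεM i]
          _ = dimM L * M := by rw [← Finset.sum_mul, sum_norm_sq_starProjection_single])
    simpa only [stack_eq_sum_blockEmb, map_sum] using this
  -- the noise in the direction `y`
  have hI : Integrable (fun ω => max (inner ℝ (stack fun i => ε i ω) y ^ 2 - θ / 8 * S) 0 ^ q) μ ∧
      ∫ ω, max (inner ℝ (stack fun i => ε i ω) y ^ 2 - θ / 8 * S) 0 ^ q ∂μ
        ≤ C₂ * 2 * (θ / 8) ^ (q - p / 2) * (dimM L * M * S ^ (q - p / 2)) := by
    have hc8 : 0 < θ / 8 * S := by positivity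
    have hy2 : ∑ i, ∑ j, y (i, j) ^ 2 ≤ 1 := by
      rw [sum_sum_sq_eq_norm_sq]; exact pow_le_one₀ (norm_nonneg _) hy
    have hIle : ∀ i (v : EuclideanSpace ℝ (Fin d)), |(inner ℝ y (blockEmb i v) : ℝ)| ≤ ‖v‖ :=
      fun i v => (abs_real_inner_le_norm _ _).trans (by
        rw [norm_blockEmb]; exact mul_le_of_le_one_left (norm_nonneg _) hy)
    have hbd : ∀ i ω, ‖(inner ℝ y (blockEmb i (ε i ω)) : ℝ)‖ ^ p
        ≤ (∑ j, y (i, j) ^ 2) * ‖ε i ω‖ ^ p :=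
      fun i ω => rpow_le_mul_rpow_of_sq_le hp (norm_nonneg _) (hIle i _) (by
        rw [Real.norm_eq_abs, sq_abs]; exact inner_blockEmb_sq_le i _ y)
    have := hros μ (fun i ω => (inner ℝ y (blockEmb i (ε i ω)) : ℝ)) τ
      (fun i => (hmI i).comp (hε i)) (hind.comp _ hmI)
      (fun i => by
        rw [integral_inner ((blockEmb i).integrable_comp (hε1 i)),
          (blockEmb i).integral_comp_comm (hε1 i), hεc i, map_zero, inner_zero_right])
      (fun i => ((hεp i).const_mul _).mono'
        (((hmI i).comp (hε i)).norm.pow_const p).aestronglyMeasurable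
        (ae_of_all _ fun ω => by
          rw [Real.norm_of_nonneg (by positivity)]; exact hbd i ω))
      hτ Finset.univ (by
        simp only [Real.norm_eq_abs, sq_abs]
        refine (hweak y).trans (mul_le_of_le_one_right (by positivity) ?_)
        exact pow_le_one₀ (norm_nonneg _) hy)
    have e : ∀ ω, ∑ i, (inner ℝ y (blockEmb i (ε i ω)) : ℝ)
        = inner ℝ (stack fun i => ε i ω) y := fun ω => by
      rw [real_inner_comm, stack_eq_sum_blockEmb, inner_sum]
    simp only [e, Real.norm_eq_abs] at this hbd
    have hsum : ∑ i, ∫ ω, |(inner ℝ y (blockEmb i (ε i ω)) : ℝ)| ^ p ∂μ ≤ M := by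
      calc ∑ i, ∫ ω, |(inner ℝ y (blockEmb i (ε i ω)) : ℝ)| ^ p ∂μ
          ≤ ∑ i, (∑ j, y (i, j) ^ 2) * M := Finset.sum_le_sum fun i _ => by
            refine (integral_mono_of_nonneg (ae_of_all _ fun ω => by positivity)
              ((hεp i).const_mul _) (ae_of_all _ fun ω => hbd i ω)).trans ?_
            rw [integral_const_mul, hεM i]
        _ ≤ M := by rw [← Finset.sum_mul]; exact mul_le_of_le_one_left hM0 hy2
    have hle : ∀ ω, max (inner ℝ (stack fun i => ε i ω) y ^ 2 - θ / 8 * S) 0 ^ q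
        ≤ |(inner ℝ (stack fun i => ε i ω) y : ℝ)| ^ p * (θ / 8 * S) ^ (q - p / 2) := fun ω => by
      refine (max_sub_rpow_le hq hqp hc8).trans (le_of_eq ?_)
      rw [max_eq_left (sq_nonneg _), ← sq_abs, ← Real.rpow_natCast,
        ← Real.rpow_mul (abs_nonneg _)]
      congr 2; push_cast; ring
    have hmst : Measurable fun ω => (inner ℝ (stack fun i => ε i ω) y : ℝ) := by
      simp only [← e]
      exact Finset.measurable_sum _ fun i _ => (hmI i).comp (hε i)
    have hi : Integrable (fun ω => max (inner ℝ (stack fun i => ε i ω) y ^ 2 - θ / 8 * S) 0 ^ q)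
        μ := (this.1.mul_const _).mono'
      ((((hmst.pow_const 2).sub_const _).max measurable_const).pow_const q).aestronglyMeasurable
      (ae_of_all _ fun ω => by rw [Real.norm_of_nonneg (by positivity)]; exact hle ω)
    refine ⟨hi, (integral_mono hi (this.1.mul_const _) hle).trans ?_⟩
    rw [integral_mul_const, Real.mul_rpow (by positivity) hS.le]
    calc (∫ ω, |(inner ℝ (stack fun i => ε i ω) y : ℝ)| ^ p ∂μ)
          * ((θ / 8) ^ (q - p / 2) * S ^ (q - p / 2))
        ≤ (C₂ * (1 * M + 1 * M)) * ((θ / 8) ^ (q - p / 2) * S ^ (q - p / 2)) := by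
          gcongr
          refine this.2.trans ?_
          rw [hτp, one_mul]
          gcongr
      _ ≤ (C₂ * (dimM L * M + dimM L * M)) * ((θ / 8) ^ (q - p / 2) * S ^ (q - p / 2)) := by
          gcongr
      _ = _ := by ring
  have hle : ∀ ω, excess θ S L y (stack fun i => ε i ω) ^ q
      ≤ 2 ^ q * (max (‖L.starProjection (stack fun i => ε i ω)‖ ^ 2 - (1 + θ / 4) * S) 0 ^ q
        + max (inner ℝ (stack fun i => ε i ω) y ^ 2 - θ / 8 * S) 0 ^ q) := fun ω =>
    add_rpow_le_two_mul hq.le (le_max_right _ _) (le_max_right _ _)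
  have hmeas : Measurable fun ω => excess θ S L y (stack fun i => ε i ω) ^ q :=
    (measurable_excess (measurable_stack hε) θ S L y).pow_const q
  have hi' : Integrable (fun ω => 2 ^ q *
      (max (‖L.starProjection (stack fun i => ε i ω)‖ ^ 2 - (1 + θ / 4) * S) 0 ^ q
        + max (inner ℝ (stack fun i => ε i ω) y ^ 2 - θ / 8 * S) 0 ^ q)) μ :=
    (hP.1.add hI.1).const_mul _
  have hi : Integrable (fun ω => excess θ S L y (stack fun i => ε i ω) ^ q) μ :=
    hi'.mono' hmeas.aestronglyMeasurable (ae_of_all _ fun ω => by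
      rw [Real.norm_of_nonneg (Real.rpow_nonneg (excess_nonneg _ _ _ _ _) q)]; exact hle ω)
  refine ⟨hi, (integral_mono hi hi' hle).trans ?_⟩
  rw [integral_const_mul, integral_add hP.1 hI.1]
  calc _ ≤ 2 ^ q * (C₁ * (dimM L * M * S ^ (q - p / 2))
        + C₂ * 2 * (θ / 8) ^ (q - p / 2) * (dimM L * M * S ^ (q - p / 2))) :=
      mul_le_mul_of_nonneg_left (add_le_add hP.2 hI.2) (by positivity)
    _ = _ := by ring

end MultiReg

/-! ### The selected estimator -/

theorem corollary4p2 :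
    ∀ θ : ℝ, 0 < θ → ∃ K : ℝ, 1 < K ∧
    ∀ q p : ℝ, 0 < q → 2 * (1 + q) < p → ∃ C : ℝ, 0 < C ∧
    ∀ (N d : ℕ) [NeZero N]
      {Ω : Type*} [MeasurableSpace Ω] (μ : Measure Ω) [IsProbabilityMeasure μ]
      (ε : Fin N → Ω → EuclideanSpace ℝ (Fin d))
      (Φ : Matrix (Fin d) (Fin d) ℝ)
      (f : Fin N → EuclideanSpace ℝ (Fin d))
      {ι : Type*} [Fintype ι] [Nonempty ι]
      (L : ι → Submodule ℝ (MultiReg.Vec N d))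
      (mhat : Ω → ι),
      -- i.i.d. centred errors with covariance matrix `Φ` and a finite moment of order `p`
      (∀ i, Measurable (ε i)) →
      iIndepFun ε μ →
      (∀ i, IdentDistrib (ε i) (ε 0) μ μ) →
      Integrable (fun ω => ‖ε 0 ω‖ ^ p) μ →
      ∫ ω, ε 0 ω ∂μ = 0 →
      MultiReg.covMatrix μ (ε 0) = Φ →
      -- the models: dimensions at least one, and `δ_m > 0`, so that `δ_m ^ (-p)` makes sense
      (∀ m, 1 ≤ MultiReg.dimM (L m)) →
      (∀ m, 0 < MultiReg.deltaSq Φ (L m)) →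
      -- a measurable penalized choice of the model from the data `y_i = f^i + ε_i`
      (∀ m, MeasurableSet (mhat ⁻¹' {m})) →
      (∀ ω, MultiReg.IsPenalizedChoice θ Φ L
        (MultiReg.stack fun i => f i + ε i ω) (mhat ω)) →
      Integrable (fun ω => MultiReg.normN (MultiReg.stack f -
        MultiReg.proj (L (mhat ω)) (MultiReg.stack fun i => f i + ε i ω)) ^ (2 * q)) μ ∧
      (∫ ω, MultiReg.normN (MultiReg.stack f -
        MultiReg.proj (L (mhat ω)) (MultiReg.stack fun i => f i + ε i ω)) ^ (2 * q) ∂μ) ^ (1 / q)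
        ≤ (2 : ℝ) ^ (max (q - 1) 0) *
          (K * MultiReg.oracle Φ L (MultiReg.stack f)
            + MultiReg.Delta C p q (∫ ω, ‖ε 0 ω‖ ^ p ∂μ) Φ L / (N : ℝ)
              * MultiReg.deltaSupSq Φ L) := by
  intro θ hθ
  set K₁ : ℝ := 5 / 2 + 2 / θ with hK₁def
  have hK₁ : 1 < K₁ := by
    have : 0 < 2 / θ := by positivity
    linarith
  set K₀ : ℝ := K₁ * (2 + 2 * θ) with hK₀def
  have hK₀ : 1 < K₀ := by nlinarith
  -- the factor `2` makes room for the quasi-norm inequality when `q < 1`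
  refine ⟨2 * K₀, by linarith, ?_⟩
  intro q p hq hpq
  obtain ⟨C₁, hC₁, hex⟩ := MultiReg.exists_integral_excess_rpow_le (θ := θ) (p := p) (q := q) hθ
    (by linarith) hq (by linarith)
  obtain ⟨C₂, hC₂, hquasi⟩ := MultiReg.exists_integral_rpow_rpow_inv_le hq
  refine ⟨C₂ ^ q * ((2 * K₁) ^ q * (2 ^ q * (2 * C₁))), by positivity, ?_⟩
  intro N d _ Ω _ μ _ ε Φ f ι _ _ L mhat hε hind hid hint hcen hΦ hD hδ hmhat hpen
  subst hΦ
  set Φ := MultiReg.covMatrix μ (ε 0) with hΦ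
  set M := ∫ ω, ‖ε 0 ω‖ ^ p ∂μ with hM
  have hM0 : 0 ≤ M := integral_nonneg fun ω => by positivity
  have hN : (0 : ℝ) < N := Nat.cast_pos.2 (NeZero.pos N)
  have hDpos : ∀ m, (0 : ℝ) < MultiReg.dimM (L m) := fun m => by
    exact_mod_cast (hD m)
  set S : ι → ℝ := fun m => MultiReg.deltaSq Φ (L m) * MultiReg.dimM (L m) with hSdef
  have hS : ∀ m, 0 < S m := fun m => mul_pos (hδ m) (hDpos m)
  set F := MultiReg.stack f with hF
  set e : Ω → MultiReg.Vec N d := fun ω => MultiReg.stack fun i => ε i ω with he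
  have hstack : ∀ ω, (MultiReg.stack fun i => f i + ε i ω) = F + e ω := fun ω => by
    simp only [hF, he, MultiReg.stack_eq_sum_blockEmb, map_add, Finset.sum_add_distrib]
  set W : ι → Ω → ℝ := fun m ω =>
    MultiReg.excess θ (S m) (L m) (MultiReg.biasDir (L m) F) (e ω) with hW
  have hW0 : ∀ m ω, 0 ≤ W m ω := fun m ω => MultiReg.excess_nonneg _ _ _ _ _
  have hWm : ∀ m, Integrable (fun ω => W m ω ^ q) μ ∧
      ∫ ω, W m ω ^ q ∂μ ≤ C₁ * (M * (MultiReg.dimM (L m) * S m ^ (q - p / 2))) := fun m =>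
    hex N d μ ε (ε 0) (L m) _ (S m) hε (hε 0) hind hid hint hcen (hD m) rfl (hS m)
      (MultiReg.norm_biasDir_le _ _)
  -- the model `m₀` attains the oracle bound
  obtain ⟨m₀, hm₀⟩ := exists_eq_ciInf_of_finite (f := fun m =>
    MultiReg.normN (F - MultiReg.proj (L m) F) ^ 2
      + MultiReg.deltaSq Φ (L m) * (MultiReg.dimM (L m) : ℝ) / (N : ℝ))
  have horacle : MultiReg.oracle Φ L F = (‖F - (L m₀).starProjection F‖ ^ 2 + S m₀) / N := by
    rw [MultiReg.oracle, ← hm₀, MultiReg.normN_sq, ← add_div]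
    rfl
  set l : Ω → ℝ := fun ω => ‖F - (L (mhat ω)).starProjection (F + e ω)‖ ^ 2 / N with hl
  have hloss : ∀ ω, MultiReg.normN (F - MultiReg.proj (L (mhat ω)) (F + e ω)) ^ (2 * q)
      = l ω ^ q := fun ω => by
    rw [Real.rpow_mul (by exact Real.sqrt_nonneg _), Real.rpow_two, MultiReg.normN_sq]
    rfl
  set b : Ω → ℝ := fun ω => 2 * K₁ / N * (W (mhat ω) ω + W m₀ ω) with hb
  have hlb : ∀ ω, l ω ≤ K₀ * MultiReg.oracle Φ L F + b ω := by
    intro ω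
    have h := hpen ω m₀
    rw [hstack, MultiReg.normN_sq, MultiReg.normN_sq, MultiReg.pen, MultiReg.pen,
      ← mul_div_assoc, ← mul_div_assoc, ← add_div, ← add_div, div_le_div_iff_of_pos_right hN] at h
    have h' := MultiReg.norm_sq_sub_le_of_penalized_le (L (mhat ω)) (L m₀) F (e ω) hθ
      (hS _).le (hS m₀).le h
    rw [horacle]
    simp only [hl, hb]
    rw [div_le_iff₀ hN]
    have hr : ∀ A B : ℝ, (K₀ * (A / N) + 2 * K₁ / N * B) * N = K₀ * A + 2 * K₁ * B :=
      fun A B => by field_simp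
    rw [hr]
    exact h'
  have hme : Measurable e := MultiReg.measurable_stack hε
  have hml : Measurable l := by
    have h : ∀ m, Measurable fun ω => ‖F - (L m).starProjection (F + e ω)‖ ^ 2 / N := fun m =>
      ((((L m).starProjection.continuous.measurable.comp
        (hme.const_add F)).const_sub F).norm.pow_const 2).div_const _
    exact MultiReg.measurable_apply_of_countable h hmhat
  have hmW : ∀ m, Measurable (W m) := fun m => MultiReg.measurable_excess hme _ _ _ _
  have hmb : Measurable b :=
    ((MultiReg.measurable_apply_of_countable hmW hmhat).add (hmW m₀)).const_mul _
  set G : ℝ := ∑ m, Real.sqrt (MultiReg.deltaSq Φ (L m)) ^ (-p)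
    * (MultiReg.dimM (L m) : ℝ) ^ (-(p / 2 - 1 - q)) with hG
  have hG0 : 0 ≤ G := Finset.sum_nonneg fun m _ => by positivity
  set D := MultiReg.deltaSupSq Φ L with hDsup
  have hDle : ∀ m, MultiReg.deltaSq Φ (L m) ≤ D := fun m =>
    le_ciSup (f := fun m => MultiReg.deltaSq Φ (L m)) (Set.finite_range _).bddAbove m
  have hD0 : 0 ≤ D := (hδ m₀).le.trans (hDle m₀)
  have hble : ∀ ω, b ω ^ q ≤ (2 * K₁ / N) ^ q * (2 ^ q * (2 * ∑ m, W m ω ^ q)) := by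
    intro ω
    have hK : 0 ≤ 2 * K₁ / N := by positivity
    simp only [hb]
    rw [Real.mul_rpow hK (add_nonneg (hW0 _ _) (hW0 _ _))]
    have h1 : ∀ m, W m ω ^ q ≤ ∑ m, W m ω ^ q := fun m =>
      Finset.single_le_sum (f := fun m => W m ω ^ q)
        (fun m _ => Real.rpow_nonneg (hW0 m ω) q) (Finset.mem_univ m)
    gcongr
    refine (MultiReg.add_rpow_le_two_mul hq.le (hW0 _ _) (hW0 _ _)).trans ?_
    gcongr
    linarith [h1 (mhat ω), h1 m₀]
  have hbi2 : Integrable (fun ω => (2 * K₁ / N) ^ q * (2 ^ q * (2 * ∑ m, W m ω ^ q))) μ :=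
    (((integrable_finsetSum _ fun m _ => (hWm m).1).const_mul _).const_mul _).const_mul _
  have hb0 : ∀ ω, 0 ≤ b ω := fun ω =>
    mul_nonneg (by positivity) (add_nonneg (hW0 _ _) (hW0 _ _))
  have hbi : Integrable (fun ω => b ω ^ q) μ :=
    hbi2.mono' (hmb.pow_const q).aestronglyMeasurable (ae_of_all _ fun ω => by
      rw [Real.norm_of_nonneg (Real.rpow_nonneg (hb0 ω) q)]; exact hble ω)
  set C' : ℝ := (2 * K₁) ^ q * (2 ^ q * (2 * C₁)) with hC'
  have hC'0 : 0 < C' := by positivity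
  -- here one factor `δ_m ^ (2 q)` of the moment bound is replaced by `δ_sup ^ (2 q)`
  have hterm : ∀ m, (MultiReg.dimM (L m) : ℝ) * S m ^ (q - p / 2)
      ≤ D ^ q * (Real.sqrt (MultiReg.deltaSq Φ (L m)) ^ (-p)
        * (MultiReg.dimM (L m) : ℝ) ^ (-(p / 2 - 1 - q))) := by
    intro m
    have e1 : Real.sqrt (MultiReg.deltaSq Φ (L m)) ^ (-p)
        = MultiReg.deltaSq Φ (L m) ^ (-(p / 2)) := by
      rw [Real.sqrt_eq_rpow, ← Real.rpow_mul (hδ m).le]; congr 1; ring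
    have e2 : S m ^ (q - p / 2) = MultiReg.deltaSq Φ (L m) ^ q
        * MultiReg.deltaSq Φ (L m) ^ (-(p / 2)) * (MultiReg.dimM (L m) : ℝ) ^ (q - p / 2) := by
      simp only [hSdef]
      rw [Real.mul_rpow (hδ m).le (hDpos m).le, ← Real.rpow_add (hδ m), sub_eq_add_neg]
    have e3 : (MultiReg.dimM (L m) : ℝ) ^ (-(p / 2 - 1 - q))
        = (MultiReg.dimM (L m) : ℝ) ^ (q - p / 2) * MultiReg.dimM (L m) := by
      rw [← Real.rpow_add_one (hDpos m).ne']; congr 1; ring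
    rw [e1, e2, e3]
    have h1 : MultiReg.deltaSq Φ (L m) ^ q ≤ D ^ q :=
      Real.rpow_le_rpow (hδ m).le (hDle m) hq.le
    have h2 : 0 ≤ MultiReg.deltaSq Φ (L m) ^ (-(p / 2)) := Real.rpow_nonneg (hδ m).le _
    calc _ = MultiReg.deltaSq Φ (L m) ^ q * (MultiReg.deltaSq Φ (L m) ^ (-(p / 2))
          * ((MultiReg.dimM (L m) : ℝ) ^ (q - p / 2) * MultiReg.dimM (L m))) := by ring
      _ ≤ _ := by gcongr
  have hby : ∫ ω, b ω ^ q ∂μ ≤ (D / N * (C' * M * G) ^ (1 / q)) ^ q := by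
    have hr : (D / N * (C' * M * G) ^ (1 / q)) ^ q = (D ^ q / (N : ℝ) ^ q) * (C' * M * G) := by
      rw [Real.mul_rpow (by positivity) (by positivity), Real.div_rpow hD0 hN.le,
        ← Real.rpow_mul (by positivity), one_div_mul_cancel hq.ne', Real.rpow_one]
    rw [hr]
    refine (integral_mono hbi hbi2 hble).trans ?_
    rw [integral_const_mul, integral_const_mul, integral_const_mul,
      integral_finsetSum _ fun m _ => (hWm m).1]
    calc (2 * K₁ / N) ^ q * (2 ^ q * (2 * ∑ m, ∫ ω, W m ω ^ q ∂μ))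
        ≤ (2 * K₁ / N) ^ q * (2 ^ q * (2 * ∑ m, C₁ * (M * (D ^ q *
          (Real.sqrt (MultiReg.deltaSq Φ (L m)) ^ (-p)
            * (MultiReg.dimM (L m) : ℝ) ^ (-(p / 2 - 1 - q))))))) := by
          gcongr with m
          refine (hWm m).2.trans (mul_le_mul_of_nonneg_left ?_ hC₁.le)
          exact mul_le_mul_of_nonneg_left (hterm m) hM0
      _ = _ := by
          rw [← Finset.mul_sum, ← Finset.mul_sum, ← Finset.mul_sum,
            Real.div_rpow (by positivity) hN.le, hC']
          ring
  have horacle0 : 0 ≤ MultiReg.oracle Φ L F := by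
    rw [horacle]
    have := hS m₀
    positivity
  have hfin := hquasi μ l b (K₀ * MultiReg.oracle Φ L F) (D / N * (C' * M * G) ^ (1 / q))
    (by positivity) (by positivity) (hml.pow_const q).aestronglyMeasurable
    (fun ω => by positivity) hb0 hlb hbi hby
  simp only [hstack, hloss]
  refine ⟨hfin.1, hfin.2.trans ?_⟩
  have hΔ : MultiReg.Delta (C₂ ^ q * C') p q M Φ L = C₂ * (C' * M * G) ^ (1 / q) := by
    rw [MultiReg.Delta, mul_assoc (C₂ ^ q), mul_assoc (C₂ ^ q),
      Real.mul_rpow (by positivity) (by positivity), ← Real.rpow_mul hC₂.le,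
      mul_one_div_cancel hq.ne', Real.rpow_one]
  rw [hΔ]
  have h2 : (1 : ℝ) ≤ 2 ^ max (q - 1) 0 := Real.one_le_rpow (by norm_num) (le_max_right _ _)
  calc 2 * (K₀ * MultiReg.oracle Φ L F) + C₂ * (D / N * (C' * M * G) ^ (1 / q))
      = 2 * K₀ * MultiReg.oracle Φ L F + C₂ * (C' * M * G) ^ (1 / q) / N * D := by ring
    _ ≤ _ := le_mul_of_one_le_left (by positivity) h2
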